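/- Consider a device that sends status packets to its receiver over a shared noisy channel. Packets arrive at the device at rate $\lambda>0$ (Poisson arrivals); a packet is generated at the moment it arrives. The device is idle, waiting, or in service. A packet arriving at an idle device is stored and the device starts waiting; a packet arriving at a waiting device replaces the stored one. Let $w>0$ be the backoff rate, $\gamma>0$ the number of devices per channel, and $\boldsymbol\pi=(\pi_I,\pi_W,\pi_S)$ a given probability vector of the fractions of idle, waiting and serving devices (in particular, the stationary distribution of a device), with $\gamma\pi_S<1$. The device moves from waiting to service at the effective waiting rate $k=w(1-\gamma\pi_S)$. A transmission ends at rate $\mu>0$ and is successful with probability $p\in(0,1]$, independently of everything else. All these durations are exponential and independent, so that the mode of the device is a continuous-time Markov chain. After a successful transmission the device becomes idle. After a failed transmission it becomes idle under policy (I) (the packet is dropped), goes back to waiting with its packet under policy (W), and stays in service with its packet under policy (S). A packet arriving during service replaces the packet in service in the scheme with preemption (WP), and is discarded in the scheme without preemption (WOP). The age of information (AoI) is $\Delta(t)=t-U(t)$, where $U(t)$ is the generation time of the packet most recently received by time $t$, and the average AoI is $\bar\Delta=\lim_{\tau\to\infty}\frac1\tau\int_0^\tau\Delta(t)\,dt$.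 Then, almost surely and from every initial state, this limit exists, and for the three policies and the two schemes it equals $$\bar\Delta_{\text{I-WP}}=\Big(\frac1\lambda+\frac1k+\frac1\mu\Big)\frac1p+\frac{\lambda+k+\mu}{(\lambda+\mu)(\lambda+k)}-\frac{\lambda+k+\mu}{\lambda k+k\mu+\lambda\mu},$$ $$\bar\Delta_{\text{I-WOP}}=\Big(\frac1\lambda+\frac1k+\frac1\mu\Big)\frac1p+\frac1\mu+\frac1{\lambda+k}-\frac{\lambda+k+\mu}{\lambda k+k\mu+\lambda\mu},$$ $$\bar\Delta_{\text{W-WP}}=\Big(\frac p\lambda+\frac1k+\frac1\mu\Big)\frac1p+\frac{\lambda+k+\mu}{(\lambda+\mu)(k+\lambda)-k\mu(1-p)}-\frac{\lambda+k+\mu}{\lambda k+\lambda\mu+k\mu p},$$ $$\bar\Delta_{\text{W-WOP}}=\Big(\frac p\lambda+\frac1k+\frac1\mu\Big)\frac1p+\frac{\lambda+k+\mu}{\mu(kp+\lambda)}-\frac{\lambda+k+\mu}{\lambda k+\lambda\mu+k\mu p},$$ $$\bar\Delta_{\text{S-WP}}=\frac1\lambda+\frac1k+\frac1{\mu p}+\frac{\mu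 p+k+\lambda}{(\lambda+\mu p)(\lambda+k)}-\frac{\lambda+k+\mu p}{\lambda k+(k+\lambda)\mu p},$$ $$\bar\Delta_{\text{S-WOP}}=\frac1\lambda+\frac1k+\frac2{\mu p}+\frac1{\lambda+k}-\frac{\lambda+k+\mu p}{\lambda k+(k+\lambda)\mu p}.$$ -/

import Mathlib

open MeasureTheory ProbabilityTheory Filter Topology

noncomputable section

namespace AoI

/-- The three modes of a device: idle (I), waiting (W), in service (S). -/
inductive Mode where
  | idle
  | waiting
  | service

instance : Fintype Mode where
  elems := ⟨{.idle, .waiting, .service}, by simp⟩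
  complete := by rintro (_ | _ | _) <;> simp

/-- What a device does when a transmission has failed: policy (I) releases the channel and goes
idle, policy (W) goes back to waiting, policy (S) stays in service. -/
inductive Policy where
  | I
  | W
  | S

/-- Packet management: with preemption in service (WP) or without (WOP). -/
inductive Scheme where
  | WP
  | WOP

/-- The events that can happen to a device. -/
inductive Event where
  /-- a new status packet arrives at the device -/
  | arrival
  /-- the waiting period ends and the device starts to transmit -/
  | access
  /-- a transmission ends and the packet reaches the receiver -/
  | success
  /-- a transmission ends and the packet is lost on the noisy channel -/
  | failure

/-- State of a device together with its receiver. -/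
structure DeviceState where
  /-- the mode of the device -/
  mode : Mode
  /-- generation time of the packet most recently received by the receiver -/
  received : ℝ
  /-- generation time of the packet currently held by the device (irrelevant when idle) -/
  stored : ℝ

/-- The mode entered after a failed transmission. -/
def Policy.modeAfterFailure : Policy → Mode
  | .I => .idle
  | .W => .waiting
  | .S => .service

/-- The state after an event that happens at time `t`. Packets are generated when they arrive.
A packet arriving at an idle device is stored and the device starts waiting; a packet arriving at
a waiting device replaces the stored one; a packet arriving during service replaces the stored one
under WP and is discarded under WOP. -/
def update (pol : Policy) (sch : Scheme) (t : ℝ) (e : Event) (x : DeviceState) : DeviceState :=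
  match x.mode, e with
  | .idle, .arrival => ⟨.waiting, x.received, t⟩
  | .waiting, .arrival => ⟨.waiting, x.received, t⟩
  | .waiting, .access => ⟨.service, x.received, x.stored⟩
  | .service, .arrival =>
      match sch with
      | .WP => ⟨.service, x.received, t⟩
      | .WOP => x
  | .service, .success => ⟨.idle, x.stored, x.stored⟩
  | .service, .failure => ⟨pol.modeAfterFailure, x.received, x.stored⟩
  | _, _ => x

/-- The random input of one jump: the time to the next packet arrival, the remaining waiting
time, the remaining transmission time, and the outcome of the transmission. -/
abbrev Clocks : Type := ℝ × ℝ × ℝ × Bool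

/-- Time to the next packet arrival. -/
def Clocks.arr (c : Clocks) : ℝ := c.1

/-- Remaining waiting time. -/
def Clocks.wait (c : Clocks) : ℝ := c.2.1

/-- Remaining transmission time. -/
def Clocks.trans (c : Clocks) : ℝ := c.2.2.1

/-- Outcome of the transmission. -/
def Clocks.ok (c : Clocks) : Bool := c.2.2.2

/-- Time until the next event: the first of the clocks that run in the given mode. -/
def holdingTime (c : Clocks) : Mode → ℝ
  | .idle => c.arr
  | .waiting => min c.arr c.wait
  | .service => min c.arr c.trans

/-- The next event: that of the first clock to ring in the given mode. -/
def nextEvent (c : Clocks) : Mode → Event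
  | .idle => .arrival
  | .waiting => if c.arr ≤ c.wait then .arrival else .access
  | .service => if c.arr ≤ c.trans then .arrival else if c.ok then .success else .failure

/-- Time of the `n`-th event and the state right after it, for the input sequence `c` and the
initial state `x₀` at time `0`. -/
def run (pol : Policy) (sch : Scheme) (c : ℕ → Clocks) (x₀ : DeviceState) : ℕ → ℝ × DeviceState
  | 0 => (0, x₀)
  | n + 1 =>
    let t := (run pol sch c x₀ n).1
    let x := (run pol sch c x₀ n).2
    let t' := t + holdingTime (c n) x.mode
    (t', update pol sch t' (nextEvent (c n) x.mode) x)

/-- Number of events in `[0, t]`. -/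
def eventCount (pol : Policy) (sch : Scheme) (c : ℕ → Clocks) (x₀ : DeviceState) (t : ℝ) : ℕ :=
  sSup {n : ℕ | (run pol sch c x₀ n).1 ≤ t}

/-- State of the device at time `t`. -/
def stateAt (pol : Policy) (sch : Scheme) (c : ℕ → Clocks) (x₀ : DeviceState) (t : ℝ) :
    DeviceState :=
  (run pol sch c x₀ (eventCount pol sch c x₀ t)).2

/-- Age of information `Δ(t) = t - U(t)`, with `U(t)` the generation time of the packet most
recently received at time `t`. -/
def age (pol : Policy) (sch : Scheme) (c : ℕ → Clocks) (x₀ : DeviceState) (t : ℝ) : ℝ :=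
  t - (stateAt pol sch c x₀ t).received

/-- `a` is the long-run time average of `f` over `[0, ∞)`. -/
def IsTimeAverage (f : ℝ → ℝ) (a : ℝ) : Prop :=
  (∀ τ : ℝ, 0 ≤ τ → IntervalIntegrable f volume 0 τ) ∧
    Tendsto (fun τ : ℝ => (1 / τ) * ∫ t in (0 : ℝ)..τ, f t) atTop (𝓝 a)

/-- Law of the input of one jump: independent exponential clocks with rates `lam` (arrivals),
`k` (end of waiting) and `μ` (end of transmission), and success with probability `p`. -/
def clockLaw (lam k μ : ℝ) (p : unitInterval) : Measure Clocks :=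
  (expMeasure lam).prod ((expMeasure k).prod ((expMeasure μ).prod (bernoulliMeasure true false p)))

/-- `C` is an i.i.d. sequence of inputs with law `clockLaw`. By competing exponential clocks, the
process `stateAt` driven by `C` is the continuous-time Markov jump process in which arrivals occur
at rate `lam` in every mode, waiting ends at rate `k`, and transmissions end successfully at rate
`μ * p` and unsuccessfully at rate `μ * (1 - p)`. -/
structure IsClockSequence {Ω : Type*} [MeasurableSpace Ω] (P : Measure Ω)
    (lam k μ : ℝ) (p : unitInterval) (C : ℕ → Ω → Clocks) : Prop where
  /-- the inputs of different jumps are independent -/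
  indep : iIndepFun C P
  /-- every input has the prescribed law -/
  law : ∀ n, HasLaw (C n) (clockLaw lam k μ p) P

/-- The average age of information of a device is `a`: almost surely, from every initial state,
the long-run time average of the age process exists and equals `a`. -/
def HasAverageAge {Ω : Type*} [MeasurableSpace Ω] (P : Measure Ω) (C : ℕ → Ω → Clocks)
    (pol : Policy) (sch : Scheme) (a : ℝ) : Prop :=
  ∀ᵐ ω ∂P, ∀ x₀ : DeviceState, IsTimeAverage (age pol sch (fun n => C n ω) x₀) a

/-- Effective waiting rate: `w` times the probability `1 - γ π_S` that a sensed channel is idle,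
when a fraction `π_S` of the devices is in service and there are `γ` devices per channel. -/
def effectiveRate (w γ : ℝ) (π : Mode → ℝ) : ℝ := w * (1 - γ * π .service)

end AoI

end

/-!
The time average of the age is computed from a Poisson equation.

Between two jumps the age grows at rate one, so the integral of the age up to the `n`-th jump is a
sum of contributions `d * H + H ^ 2 / 2`, where `d` is the age at the beginning of a jump interval
and `H` its length. Measured from the current time, the state after each jump is a function
`relStep` of the state before it and of the fresh input, hence a Markov chain. For each policy and
scheme there is a function `φ` of this state, affine in the ages of the received and of the stored
packet with coefficients depending on the mode, and a constant `a` such that the generator of the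
Markov jump process maps `φ` to `a - age` (`Potential.IsPoissonSolution`). Comparing coefficients
makes this a triangular linear system (`Potential.isPoissonSolution_of_coefficients`), whose
solvability condition yields the six values of `a` in the theorem.

The Poisson equation says exactly that `d * H + H ^ 2 / 2 - a * H` plus the increment of `φ` has
mean zero given the past (`Potential.integral_jumpGain`); this rests on the fact that the first
ring of two competing exponential clocks is exponential and independent of which clock rings
(`integral_competing_clocks`). The compensated contributions are therefore orthogonal, and by a
strong law of large numbers for orthogonal variables bounded in `L²`
(`ae_tendsto_mean_of_orthogonal`) their sum up to `n` is `o(n)`. The values of `φ` are `o(n)`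
as well, and the jump times grow at least linearly (`IsClockSequence.exists_linear_growth`), so the
time average of the age tends to `a` (`isTimeAverage_of_sawtooth`).

The required `L²` bounds come from forgetting: with a fixed positive probability five consecutive
inputs force the generation and the delivery of a packet, whatever the state, after which both ages
are at most the time elapsed during these five jumps (`size_five_good_le`,
`IsClockSequence.exists_integral_size_sq_le`). Finally, the age depends affinely on the
initial generation times, so that three initial states for each mode suffice
(`isTimeAverage_age_of_basis`) and a single null set serves all initial states.
-/

open MeasureTheory ProbabilityTheory Filter Topology

noncomputable section

namespace AoI

/-! ### Exponential clocks -/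

theorem expMeasure_eq_withDensity (r : ℝ) :
    expMeasure r = (volume.restrict (Set.Ioi 0)).withDensity
      (fun x => ENNReal.ofReal (r * Real.exp (-(r * x)))) := by
  have h : expMeasure r = volume.withDensity (exponentialPDF r) := rfl
  rw [h, ← withDensity_indicator measurableSet_Ioi]
  refine withDensity_congr_ae ?_
  have h0 : ∀ᵐ x : ℝ, x ≠ 0 := by simp [ae_iff, measure_singleton]
  filter_upwards [h0] with x hx
  rw [exponentialPDF_eq]
  rcases lt_or_gt_of_ne hx with h | h
  · simp [h.le, not_le.2 h, Set.indicator]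
  · simp [h.le, h, Set.indicator]

theorem integral_expMeasure {r : ℝ} (hr : 0 < r) (f : ℝ → ℝ) :
    ∫ x, f x ∂(expMeasure r) = ∫ x in Set.Ioi 0, r * Real.exp (-(r * x)) * f x := by
  rw [expMeasure_eq_withDensity, integral_withDensity_eq_integral_toReal_smul (by fun_prop) (by simp)]
  refine integral_congr_ae (Eventually.of_forall fun x => ?_)
  simp only [smul_eq_mul]
  rw [ENNReal.toReal_ofReal (by positivity)]

theorem integral_pow_expMeasure {r : ℝ} (hr : 0 < r) (n : ℕ) :
    ∫ x, x ^ n ∂(expMeasure r) = n.factorial / r ^ n := by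
  rw [integral_expMeasure hr]
  have h := Real.integral_rpow_mul_exp_neg_mul_Ioi (a := n + 1) (r := r) (by positivity) hr
  have e : ∀ x : ℝ, r * Real.exp (-(r * x)) * x ^ n
      = r * (x ^ ((n : ℝ) + 1 - 1) * Real.exp (-(r * x))) := by
    intro x
    rw [add_sub_cancel_right, Real.rpow_natCast]; ring
  simp_rw [e]
  rw [integral_const_mul, h, Real.Gamma_nat_eq_factorial]
  have : (1 / r) ^ ((n : ℝ) + 1) = (1 / r) ^ (n + 1) := by
    rw [← Real.rpow_natCast]; push_cast; rfl
  rw [this, div_pow, one_pow]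
  field_simp
  ring

/-- Integrability follows from the nonzero value of the integral. -/
theorem integrable_pow_expMeasure {r : ℝ} (hr : 0 < r) (n : ℕ) :
    Integrable (fun x => x ^ n) (expMeasure r) := by
  by_contra h
  have h1 := integral_undef h
  rw [integral_pow_expMeasure hr] at h1
  have : (0 : ℝ) < n.factorial / r ^ n := by positivity
  linarith

theorem ae_pos_expMeasure (r : ℝ) : ∀ᵐ x ∂(expMeasure r), 0 < x := by
  rw [expMeasure_eq_withDensity]
  exact (withDensity_absolutelyContinuous _ _).ae_le (ae_restrict_mem measurableSet_Ioi)

theorem expMeasure_real_Ioi {r x : ℝ} (hr : 0 < r) (hx : 0 ≤ x) :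
    (expMeasure r).real (Set.Ioi x) = Real.exp (-(r * x)) := by
  have := isProbabilityMeasure_expMeasure hr
  have h := cdf_expMeasure_eq hr x
  rw [cdf_eq_real, if_pos hx] at h
  rw [← Set.compl_Iic, measureReal_compl measurableSet_Iic, h]
  simp

theorem expMeasure_real_Ici {r x : ℝ} (hr : 0 < r) (hx : 0 ≤ x) :
    (expMeasure r).real (Set.Ici x) = Real.exp (-(r * x)) := by
  rw [← expMeasure_real_Ioi hr hx]
  have : NullMeasurableSet (Set.Ici x) volume := measurableSet_Ici.nullMeasurableSet
  refine measureReal_congr ?_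
  rw [expMeasure_eq_withDensity]
  exact (withDensity_absolutelyContinuous _ _).ae_le (ae_restrict_le Ioi_ae_eq_Ici.symm)

/-- A factor `exp (-b x)` turns the exponential law of rate `a` into that of rate `a + b`. -/
theorem integral_expMeasure_mul_exp {a b : ℝ} (ha : 0 < a) (hb : 0 < b) (f : ℝ → ℝ) :
    ∫ x, f x * Real.exp (-(b * x)) ∂(expMeasure a)
      = a / (a + b) * ∫ x, f x ∂(expMeasure (a + b)) := by
  rw [integral_expMeasure ha, integral_expMeasure (add_pos ha hb), ← integral_const_mul]
  refine integral_congr_ae (Eventually.of_forall fun x => ?_)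
  have : Real.exp (-((a + b) * x)) = Real.exp (-(a * x)) * Real.exp (-(b * x)) := by
    rw [← Real.exp_add]; ring_nf
  simp only [this]
  field_simp

/-- Competition of two independent exponential clocks: the first clock wins with probability
`a / (a + b)`, and the time of the first ring is then exponential of rate `a + b`. -/
theorem integral_competing_clocks {a b : ℝ} (ha : 0 < a) (hb : 0 < b) {f g : ℝ → ℝ}
    (hf : Integrable f (expMeasure a)) (hg : Integrable g (expMeasure b)) :
    Integrable (fun z : ℝ × ℝ => if z.1 ≤ z.2 then f z.1 else g z.2)
        ((expMeasure a).prod (expMeasure b)) ∧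
    ∫ z, (if z.1 ≤ z.2 then f z.1 else g z.2) ∂((expMeasure a).prod (expMeasure b))
      = a / (a + b) * ∫ x, f x ∂(expMeasure (a + b))
        + b / (a + b) * ∫ x, g x ∂(expMeasure (a + b)) := by
  have := isProbabilityMeasure_expMeasure ha
  have := isProbabilityMeasure_expMeasure hb
  have hm : MeasurableSet {z : ℝ × ℝ | z.1 ≤ z.2} := measurableSet_le measurable_fst measurable_snd
  have h1 : Integrable ({z : ℝ × ℝ | z.1 ≤ z.2}.indicator fun z => f z.1)
      ((expMeasure a).prod (expMeasure b)) := (hf.comp_fst _).indicator hm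
  have h2 : Integrable ({z : ℝ × ℝ | z.1 ≤ z.2}ᶜ.indicator fun z => g z.2)
      ((expMeasure a).prod (expMeasure b)) := (hg.comp_snd _).indicator hm.compl
  have e : (fun z : ℝ × ℝ => if z.1 ≤ z.2 then f z.1 else g z.2)
      = ({z : ℝ × ℝ | z.1 ≤ z.2}.indicator fun z => f z.1)
        + ({z : ℝ × ℝ | z.1 ≤ z.2}ᶜ.indicator fun z => g z.2) := by
    ext z
    by_cases h : z.1 ≤ z.2 <;> simp [h, Set.indicator]
  rw [e]
  refine ⟨h1.add h2, ?_⟩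
  rw [integral_add' h1 h2, integral_prod _ h1, integral_prod_symm _ h2,
    ← integral_expMeasure_mul_exp ha hb, add_comm a b, ← integral_expMeasure_mul_exp hb ha]
  congr 1
  · refine integral_congr_ae ?_
    filter_upwards [ae_pos_expMeasure a] with x hx
    have : (fun y => ({z : ℝ × ℝ | z.1 ≤ z.2}.indicator fun z => f z.1) (x, y))
        = (Set.Ici x).indicator fun _ => f x := by
      ext y; simp [Set.indicator]
    rw [this, integral_indicator_const _ measurableSet_Ici, expMeasure_real_Ici hb hx.le,
      smul_eq_mul, mul_comm]
  · refine integral_congr_ae ?_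
    filter_upwards [ae_pos_expMeasure b] with y hy
    have : (fun x => ({z : ℝ × ℝ | z.1 ≤ z.2}ᶜ.indicator fun z => g z.2) (x, y))
        = (Set.Ioi y).indicator fun _ => g y := by
      ext x; simp [Set.indicator]
    rw [this, integral_indicator_const _ measurableSet_Ioi, expMeasure_real_Ioi ha hy.le,
      smul_eq_mul, mul_comm]

/-! ### Almost sure limits from second moments -/

section SecondMoments

variable {Ω : Type*} [MeasurableSpace Ω] {P : Measure Ω}

theorem ae_tendsto_zero_of_integral_sq_le {Z : ℕ → Ω → ℝ} {u : ℕ → ℝ}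
    (hZ : ∀ n, MemLp (Z n) 2 P) (hu : Summable u) (h : ∀ n, ∫ ω, Z n ω ^ 2 ∂P ≤ u n) :
    ∀ᵐ ω ∂P, Tendsto (fun n => Z n ω) atTop (𝓝 0) := by
  have hsum : ∑' n, ∫⁻ ω, ENNReal.ofReal (Z n ω ^ 2) ∂P ≠ ⊤ := by
    have hs : Summable fun n => ∫ ω, Z n ω ^ 2 ∂P :=
      Summable.of_nonneg_of_le (fun n => integral_nonneg fun ω => sq_nonneg _) h hu
    have e : ∀ n, ∫⁻ ω, ENNReal.ofReal (Z n ω ^ 2) ∂P = ENNReal.ofReal (∫ ω, Z n ω ^ 2 ∂P) :=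
      fun n => (ofReal_integral_eq_lintegral_ofReal (hZ n).integrable_sq
        (Eventually.of_forall fun ω => sq_nonneg _)).symm
    simp_rw [e]
    rw [← ENNReal.ofReal_tsum_of_nonneg (fun n => integral_nonneg fun ω => sq_nonneg _) hs]
    exact ENNReal.ofReal_ne_top
  have hm : ∀ n, AEMeasurable (fun ω => ENNReal.ofReal (Z n ω ^ 2)) P := fun n =>
    ((hZ n).aestronglyMeasurable.aemeasurable.pow_const 2).ennreal_ofReal
  rw [← lintegral_tsum hm] at hsum
  filter_upwards [ae_lt_top' (AEMeasurable.tsum hm) hsum] with ω hω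
  have h1 := ENNReal.tendsto_atTop_zero_of_tsum_ne_top hω.ne
  have h2 : Tendsto (fun n => Z n ω ^ 2) atTop (𝓝 0) := by
    have := (ENNReal.tendsto_toReal ENNReal.zero_ne_top).comp h1
    refine (this.congr fun n => ?_)
    simp [ENNReal.toReal_ofReal (sq_nonneg (Z n ω))]
  have h3 := h2.sqrt
  simp only [Real.sqrt_sq_eq_abs, Real.sqrt_zero] at h3
  exact (tendsto_zero_iff_abs_tendsto_zero _).2 h3

theorem summable_const_div_sq (K : ℝ) : Summable fun n : ℕ => K / (n : ℝ) ^ 2 := by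
  simpa [div_eq_mul_inv] using
    ((Real.summable_nat_pow_inv (p := 2)).2 (by norm_num)).mul_left K

/-- A sequence bounded in `L²` is almost surely `o(n)`. -/
theorem ae_tendsto_div_nat_of_integral_sq_le {Y : ℕ → Ω → ℝ} {K : ℝ}
    (hY : ∀ n, MemLp (Y n) 2 P) (h : ∀ n, ∫ ω, Y n ω ^ 2 ∂P ≤ K) :
    ∀ᵐ ω ∂P, Tendsto (fun n : ℕ => Y n ω / n) atTop (𝓝 0) := by
  refine ae_tendsto_zero_of_integral_sq_le (u := fun n : ℕ => K / (n : ℝ) ^ 2)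
    (fun n => ?_) (summable_const_div_sq K) fun n => ?_
  · simpa [div_eq_mul_inv, mul_comm] using (hY n).const_mul ((n : ℝ)⁻¹)
  · simp_rw [div_pow]
    rw [integral_div]
    gcongr
    exact h n

/-- A strong law of large numbers for orthogonal random variables that are bounded in `L²`:
along the squares the means converge by a variance estimate, and the gaps are small. -/
theorem ae_tendsto_mean_of_orthogonal {X : ℕ → Ω → ℝ} {K : ℝ}
    (hX : ∀ n, MemLp (X n) 2 P) (hK : ∀ n, ∫ ω, X n ω ^ 2 ∂P ≤ K)
    (horth : ∀ i j, i < j → ∫ ω, X i ω * X j ω ∂P = 0) :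
    ∀ᵐ ω ∂P, Tendsto (fun n : ℕ => (∑ i ∈ Finset.range n, X i ω) / n) atTop (𝓝 0) := by
  have hK0 : 0 ≤ K := (integral_nonneg fun ω => sq_nonneg (X 0 ω)).trans (hK 0)
  have hS : ∀ n, MemLp (fun ω => ∑ i ∈ Finset.range n, X i ω) 2 P := fun n =>
    memLp_finsetSum _ fun i _ => hX i
  have hvar : ∀ n : ℕ, ∫ ω, (∑ i ∈ Finset.range n, X i ω) ^ 2 ∂P ≤ n * K := by
    intro n
    induction n with
    | zero => simp
    | succ n ih =>
      have hc : ∫ ω, (∑ i ∈ Finset.range n, X i ω) * X n ω ∂P = 0 := by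
        simp_rw [Finset.sum_mul]
        have hi : ∀ i ∈ Finset.range n, Integrable (fun ω => X i ω * X n ω) P :=
          fun i _ => (hX i).integrable_mul (hX n)
        rw [integral_finsetSum _ hi]
        exact Finset.sum_eq_zero fun i hi => horth i n (Finset.mem_range.1 hi)
      have e : ∀ ω, (∑ i ∈ Finset.range (n + 1), X i ω) ^ 2
          = (∑ i ∈ Finset.range n, X i ω) ^ 2 + 2 * ((∑ i ∈ Finset.range n, X i ω) * X n ω)
            + X n ω ^ 2 := by
        intro ω; rw [Finset.sum_range_succ]; ring
      simp_rw [e]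
      have i2 : Integrable (fun ω => 2 * ((∑ i ∈ Finset.range n, X i ω) * X n ω)) P :=
        ((hS n).integrable_mul (hX n)).const_mul 2
      have i3 : Integrable (fun ω => (∑ i ∈ Finset.range n, X i ω) ^ 2
          + 2 * ((∑ i ∈ Finset.range n, X i ω) * X n ω)) P := (hS n).integrable_sq.add i2
      rw [integral_add i3 (hX n).integrable_sq,
        integral_add (hS n).integrable_sq i2, integral_const_mul, hc]
      push_cast
      linarith [hK n]
  -- the means along the squares
  have hsq : ∀ᵐ ω ∂P, Tendsto
      (fun j : ℕ => (∑ i ∈ Finset.range (j ^ 2), X i ω) / (j : ℝ) ^ 2) atTop (𝓝 0) := by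
    refine ae_tendsto_zero_of_integral_sq_le (u := fun n : ℕ => K / (n : ℝ) ^ 2)
      (fun n => ?_) (summable_const_div_sq K) fun n => ?_
    · simpa [div_eq_mul_inv, mul_comm] using (hS (n ^ 2)).const_mul (((n : ℝ) ^ 2)⁻¹)
    · simp_rw [div_pow]
      rw [integral_div]
      rcases Nat.eq_zero_or_pos n with rfl | hn
      · simp
      · rw [div_le_div_iff₀ (by positivity) (by positivity)]
        have := hvar (n ^ 2)
        push_cast at this
        have hn' : (0 : ℝ) < (n : ℝ) ^ 2 := by positivity
        nlinarith
  -- the largest possible change between consecutive squares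
  have hgap : ∀ᵐ ω ∂P, Tendsto
      (fun j : ℕ => (∑ i ∈ Finset.Ico (j ^ 2) ((j + 1) ^ 2), |X i ω|) / (j : ℝ) ^ 2)
      atTop (𝓝 0) := by
    have hD : ∀ j : ℕ, MemLp (fun ω => ∑ i ∈ Finset.Ico (j ^ 2) ((j + 1) ^ 2), |X i ω|) 2 P :=
      fun j => memLp_finsetSum _ fun i _ => (hX i).abs
    refine ae_tendsto_zero_of_integral_sq_le (u := fun n : ℕ => (9 * K) / (n : ℝ) ^ 2)
      (fun n => ?_) (summable_const_div_sq _) fun n => ?_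
    · simpa [div_eq_mul_inv, mul_comm] using (hD n).const_mul (((n : ℝ) ^ 2)⁻¹)
    · simp_rw [div_pow]
      rw [integral_div]
      have hcard : (Finset.Ico (n ^ 2) ((n + 1) ^ 2)).card = 2 * n + 1 := by
        rw [Nat.card_Ico]
        have : (n + 1) ^ 2 = n ^ 2 + (2 * n + 1) := by ring
        omega
      have hle : ∫ ω, (∑ i ∈ Finset.Ico (n ^ 2) ((n + 1) ^ 2), |X i ω|) ^ 2 ∂P
          ≤ (2 * n + 1) ^ 2 * K := by
        calc _ ≤ ∫ ω, (2 * n + 1 : ℝ) * ∑ i ∈ Finset.Ico (n ^ 2) ((n + 1) ^ 2), X i ω ^ 2 ∂P := by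
              refine integral_mono (hD n).integrable_sq ((integrable_finsetSum _ fun i _ =>
                (hX i).integrable_sq).const_mul _) fun ω => ?_
              have := sq_sum_le_card_mul_sum_sq (s := Finset.Ico (n ^ 2) ((n + 1) ^ 2))
                (f := fun i => |X i ω|)
              rw [hcard] at this
              simpa using this
          _ = (2 * n + 1 : ℝ) * ∑ i ∈ Finset.Ico (n ^ 2) ((n + 1) ^ 2), ∫ ω, X i ω ^ 2 ∂P := by
              rw [integral_const_mul, integral_finsetSum _ fun i _ => (hX i).integrable_sq]
          _ ≤ (2 * n + 1 : ℝ) * ∑ i ∈ Finset.Ico (n ^ 2) ((n + 1) ^ 2), K := by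
              gcongr with i hi
              exact hK i
          _ = (2 * n + 1) ^ 2 * K := by
              rw [Finset.sum_const, hcard, nsmul_eq_mul]; push_cast; ring
      rcases Nat.eq_zero_or_pos n with rfl | hn
      · simp
      · rw [div_le_div_iff₀ (by positivity) (by positivity)]
        have h1 : (1 : ℝ) ≤ n := by exact_mod_cast hn
        have h2 : (2 * n + 1 : ℝ) ^ 2 ≤ 9 * (n : ℝ) ^ 2 := by nlinarith
        calc _ ≤ (2 * n + 1) ^ 2 * K * (n : ℝ) ^ 2 := by gcongr
          _ ≤ (9 * (n : ℝ) ^ 2) * K * (n : ℝ) ^ 2 := by gcongr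
          _ = _ := by ring
  filter_upwards [hsq, hgap] with ω h1 h2
  have hlim : Tendsto (fun j : ℕ => |(∑ i ∈ Finset.range (j ^ 2), X i ω) / (j : ℝ) ^ 2|
      + (∑ i ∈ Finset.Ico (j ^ 2) ((j + 1) ^ 2), |X i ω|) / (j : ℝ) ^ 2) atTop (𝓝 0) := by
    simpa using h1.abs.add h2
  have hsqrt : Tendsto Nat.sqrt atTop atTop :=
    tendsto_atTop.2 fun b => (eventually_ge_atTop (b ^ 2)).mono fun n hn =>
      Nat.le_sqrt'.2 hn
  refine squeeze_zero_norm' ?_ (hlim.comp hsqrt)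
  filter_upwards [eventually_ge_atTop 1] with n hn
  have hs1 : 1 ≤ Nat.sqrt n := Nat.le_sqrt'.2 (by simpa using hn)
  have hs2 : Nat.sqrt n ^ 2 ≤ n := Nat.sqrt_le' n
  have hs3 : n < (Nat.sqrt n + 1) ^ 2 := Nat.lt_succ_sqrt' n
  have hpos : (0 : ℝ) < (Nat.sqrt n : ℝ) ^ 2 := by
    have : (0 : ℝ) < Nat.sqrt n := by exact_mod_cast hs1
    positivity
  have hle : ((Nat.sqrt n : ℝ)) ^ 2 ≤ n := by exact_mod_cast hs2
  simp only [Function.comp, Real.norm_eq_abs]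
  rw [abs_div, abs_div, abs_of_pos hpos, ← add_div, Nat.abs_cast]
  have hnum : |∑ i ∈ Finset.range n, X i ω| ≤ |∑ i ∈ Finset.range (Nat.sqrt n ^ 2), X i ω|
      + ∑ i ∈ Finset.Ico (Nat.sqrt n ^ 2) ((Nat.sqrt n + 1) ^ 2), |X i ω| := by
    rw [← Finset.sum_range_add_sum_Ico _ hs2]
    refine (abs_add_le _ _).trans (add_le_add_right ?_ _)
    refine (Finset.abs_sum_le_sum_abs _ _).trans ?_
    exact Finset.sum_le_sum_of_subset_of_nonneg (Finset.Ico_subset_Ico_right hs3.le)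
      fun i _ _ => abs_nonneg _
  gcongr

end SecondMoments

/-! ### Time averages of sawtooth functions -/

theorem intervalIntegral_of_eq_sub {f : ℝ → ℝ} {s u v r : ℝ} (hsu : s ≤ u) (huv : u ≤ v)
    (hf : ∀ t ∈ Set.Ico s v, f t = t - r) :
    IntervalIntegrable f volume s u ∧
      ∫ t in s..u, f t = (s - r) * (u - s) + (u - s) ^ 2 / 2 := by
  have hae : ∀ᵐ t : ℝ, t ∈ Set.uIoc s u → t - r = f t := by
    have h0 : ∀ᵐ t : ℝ, t ≠ v := by simp [ae_iff, measure_singleton]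
    filter_upwards [h0] with t ht h
    rw [Set.uIoc_of_le hsu] at h
    exact (hf t ⟨h.1.le, lt_of_le_of_ne (h.2.trans huv) ht⟩).symm
  refine ⟨(Continuous.intervalIntegrable (by fun_prop : Continuous fun t : ℝ => t - r) s u).congr_ae
    ((ae_restrict_iff' measurableSet_uIoc).2 hae), ?_⟩
  rw [← intervalIntegral.integral_congr_ae hae, intervalIntegral.integral_sub (by simp) (by simp)]
  simp
  ring

/-- Renewal-reward bookkeeping: if `f` grows at rate one between the jump times `T n`, from the
value `T n - r n`, then its time average can be read off at the jump times, provided that the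
contribution of a single interval is `o(n)` and that the jump times grow linearly. -/
theorem isTimeAverage_of_sawtooth {f : ℝ → ℝ} {T r Y : ℕ → ℝ} {a δ : ℝ} (hT0 : T 0 = 0)
    (hT : StrictMono T) (hf : ∀ n, ∀ t ∈ Set.Ico (T n) (T (n + 1)), f t = t - r n)
    (hsum : Tendsto (fun n : ℕ => (∑ i ∈ Finset.range n, ((T i - r i) * (T (i + 1) - T i)
      + (T (i + 1) - T i) ^ 2 / 2 - a * (T (i + 1) - T i))) / (n : ℝ)) atTop (𝓝 0))
    (hY : ∀ n, |T n - r n| * (T (n + 1) - T n) + (T (n + 1) - T n) ^ 2 / 2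
      + |a| * (T (n + 1) - T n) ≤ Y n)
    (hYlim : Tendsto (fun n : ℕ => Y n / n) atTop (𝓝 0))
    (hδ : 0 < δ) (hlin : ∀ᶠ n : ℕ in atTop, δ * n ≤ T n) :
    IsTimeAverage f a := by
  have hTtop : Tendsto T atTop atTop :=
    tendsto_atTop_mono' _ hlin (tendsto_natCast_atTop_atTop.const_mul_atTop hδ)
  have hex : ∀ τ : ℝ, ∃ n, 0 ≤ τ → T n ≤ τ ∧ τ < T (n + 1) := by
    intro τ
    by_cases hτ : 0 ≤ τ
    · obtain ⟨m, hm⟩ : ∃ m, τ < T m := (hTtop.eventually_gt_atTop τ).exists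
      classical
      have hmin := fun k (hk : k < Nat.find (p := fun m => τ < T m) ⟨m, hm⟩) =>
        Nat.find_min (p := fun m => τ < T m) ⟨m, hm⟩ hk
      have hspec := Nat.find_spec (p := fun m => τ < T m) ⟨m, hm⟩
      rcases h : Nat.find (p := fun m => τ < T m) ⟨m, hm⟩ with _ | k
      · rw [h, hT0] at hspec; linarith
      · rw [h] at hspec
        exact ⟨k, fun _ => ⟨not_lt.1 (hmin k (by omega)), hspec⟩⟩
    · exact ⟨0, fun h => absurd h hτ⟩
  choose N hN using hex
  have hpiece : ∀ n, IntervalIntegrable f volume (T n) (T (n + 1)) ∧ ∫ t in T n..T (n + 1), f t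
      = (T n - r n) * (T (n + 1) - T n) + (T (n + 1) - T n) ^ 2 / 2 :=
    fun n => intervalIntegral_of_eq_sub (hT n.lt_succ_self).le le_rfl (hf n)
  have hlast : ∀ τ, 0 ≤ τ → IntervalIntegrable f volume (T (N τ)) τ ∧ ∫ t in T (N τ)..τ, f t
      = (T (N τ) - r (N τ)) * (τ - T (N τ)) + (τ - T (N τ)) ^ 2 / 2 :=
    fun τ hτ => intervalIntegral_of_eq_sub (hN τ hτ).1 (hN τ hτ).2.le (hf _)
  have hint : ∀ n, IntervalIntegrable f volume 0 (T n) := fun n => by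
    have := IntervalIntegrable.trans_iterate (n := n) fun k _ => (hpiece k).1
    rwa [hT0] at this
  refine ⟨fun τ hτ => (hint _).trans (hlast τ hτ).1, ?_⟩
  have hNtop : Tendsto N atTop atTop := by
    refine tendsto_atTop.2 fun b => (eventually_ge_atTop (max 0 (T b))).mono fun τ hτ => ?_
    by_contra h
    have h1 := (hN τ ((le_max_left _ _).trans hτ)).2
    have h2 : T (N τ + 1) ≤ T b := hT.monotone (by omega)
    linarith [le_max_right 0 (T b)]
  set S : ℕ → ℝ := fun n => ∑ i ∈ Finset.range n, ((T i - r i) * (T (i + 1) - T i)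
      + (T (i + 1) - T i) ^ 2 / 2 - a * (T (i + 1) - T i)) with hS
  have hTint : ∀ n, ∫ t in (0 : ℝ)..T n, f t = S n + a * T n := by
    intro n
    have h1 := intervalIntegral.sum_integral_adjacent_intervals (n := n) fun k _ => (hpiece k).1
    rw [hT0] at h1
    rw [← h1, hS]
    simp_rw [(hpiece _).2]
    rw [Finset.sum_sub_distrib, ← Finset.mul_sum, Finset.sum_range_sub, hT0]
    ring
  have herr : Tendsto (fun n : ℕ => δ⁻¹ * (|S n / n| + Y n / n)) atTop (𝓝 0) := by
    have h := (hsum.abs.add hYlim).const_mul δ⁻¹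
    rwa [abs_zero, add_zero, mul_zero] at h
  rw [tendsto_iff_norm_sub_tendsto_zero]
  refine squeeze_zero' (Eventually.of_forall fun τ => norm_nonneg _) ?_ (herr.comp hNtop)
  filter_upwards [eventually_gt_atTop 0, hNtop.eventually hlin,
    hNtop.eventually (eventually_ge_atTop 1)] with τ hτ hlinτ hN1
  obtain ⟨hle, hlt⟩ := hN τ hτ.le
  have hn : (0 : ℝ) < N τ := by exact_mod_cast hN1
  simp only [Function.comp, Real.norm_eq_abs]
  rw [← intervalIntegral.integral_add_adjacent_intervals (hint (N τ)) (hlast τ hτ.le).1, hTint,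
    (hlast τ hτ.le).2]
  set n := N τ
  set h := τ - T n with hh
  set H := T (n + 1) - T n with hH
  have h0 : 0 ≤ h := sub_nonneg.2 hle
  have hhH : h ≤ H := by rw [hh, hH]; linarith
  have e : 1 / τ * (S n + a * T n + ((T n - r n) * h + h ^ 2 / 2)) - a
      = (S n + ((T n - r n) * h + h ^ 2 / 2 - a * h)) / τ := by
    rw [hh]; field_simp; ring
  have hb : |S n + ((T n - r n) * h + h ^ 2 / 2 - a * h)| ≤ |S n| + Y n := by
    refine (abs_add_le _ _).trans (add_le_add_right (le_trans ?_ (hY n)) _)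
    refine (abs_sub _ _).trans ?_
    refine add_le_add ((abs_add_le _ _).trans ?_) ?_
    · rw [abs_mul, abs_of_nonneg h0, abs_of_nonneg (by positivity : 0 ≤ h ^ 2 / 2)]
      gcongr
    · rw [abs_mul, abs_of_nonneg h0]
      gcongr
  rw [e, abs_div, abs_of_pos hτ]
  have hY0 : 0 ≤ |S n| + Y n := (abs_nonneg _).trans hb
  calc _ ≤ (|S n| + Y n) / τ := by gcongr
    _ ≤ (|S n| + Y n) / (δ * n) := by
      gcongr
      exact hlinτ.trans hle
    _ = δ⁻¹ * (|S n / n| + Y n / n) := by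
      rw [abs_div, abs_of_pos hn]; field_simp

/-! ### The device seen from the current time -/

/-- The state with generation times measured from a clock that is ahead by `h`. -/
def DeviceState.shift (h : ℝ) (x : DeviceState) : DeviceState :=
  ⟨x.mode, x.received - h, x.stored - h⟩

/-- One jump, with generation times measured from the current time: in the result of this
function, `-received` is the age of information and `-stored` the age of the packet held. -/
def relStep (pol : Policy) (sch : Scheme) (y : DeviceState) (c : Clocks) : DeviceState :=
  update pol sch 0 (nextEvent c y.mode) (y.shift (holdingTime c y.mode))

/-- The jump chain of the state with generation times measured from the current time. -/
def relRun (pol : Policy) (sch : Scheme) (c : ℕ → Clocks) (y₀ : DeviceState) : ℕ → DeviceState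
  | 0 => y₀
  | n + 1 => relStep pol sch (relRun pol sch c y₀ n) (c n)

theorem shift_update (pol : Policy) (sch : Scheme) (h t : ℝ) (e : Event) (x : DeviceState) :
    (update pol sch t e x).shift h = update pol sch (t - h) e (x.shift h) := by
  obtain ⟨m, r, s⟩ := x
  cases m <;> cases e <;> cases sch <;> rfl

theorem shift_shift (h h' : ℝ) (x : DeviceState) : (x.shift h).shift h' = x.shift (h + h') := by
  simp [DeviceState.shift, sub_sub]

section Run

variable {pol : Policy} {sch : Scheme} {c : ℕ → Clocks} {x₀ : DeviceState}

theorem shift_run (n : ℕ) :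
    (run pol sch c x₀ n).2.shift (run pol sch c x₀ n).1 = relRun pol sch c x₀ n := by
  induction n with
  | zero => simp [run, relRun, DeviceState.shift]
  | succ n ih =>
    rw [relRun, ← ih, relStep, shift_shift]
    simp only [run]
    rw [shift_update, sub_self]
    rfl

theorem run_succ_fst (n : ℕ) : (run pol sch c x₀ (n + 1)).1
    = (run pol sch c x₀ n).1 + holdingTime (c n) (relRun pol sch c x₀ n).mode := by
  rw [← shift_run]; rfl

theorem run_fst_sub_received (n : ℕ) :
    (run pol sch c x₀ n).1 - (run pol sch c x₀ n).2.received
      = -(relRun pol sch c x₀ n).received := by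
  rw [← shift_run]; simp [DeviceState.shift]

theorem strictMono_run_fst (hc : ∀ n m, 0 < holdingTime (c n) m) :
    StrictMono fun n => (run pol sch c x₀ n).1 :=
  strictMono_nat_of_lt_succ fun n => by
    rw [run_succ_fst]; linarith [hc n (relRun pol sch c x₀ n).mode]

theorem eventCount_eq (hc : ∀ n m, 0 < holdingTime (c n) m) {n : ℕ} {t : ℝ}
    (ht : t ∈ Set.Ico (run pol sch c x₀ n).1 (run pol sch c x₀ (n + 1)).1) :
    eventCount pol sch c x₀ t = n := by
  have : {m : ℕ | (run pol sch c x₀ m).1 ≤ t} = Set.Iic n := by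
    ext m
    simp only [Set.mem_ofPred_eq, Set.mem_Iic]
    constructor
    · intro h
      by_contra hm
      have : (run pol sch c x₀ (n + 1)).1 ≤ (run pol sch c x₀ m).1 :=
        (strictMono_run_fst hc).monotone (by omega)
      linarith [ht.2]
    · intro h
      exact ((strictMono_run_fst hc).monotone h).trans ht.1
  rw [eventCount, this, csSup_Iic]

/-- The criterion `isTimeAverage_of_sawtooth` for the age process, in terms of the jump chain measured
from the current time. -/
theorem isTimeAverage_age {Y : ℕ → ℝ} {a δ : ℝ} (hc : ∀ n m, 0 < holdingTime (c n) m)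
    (hsum : Tendsto (fun n : ℕ => (∑ i ∈ Finset.range n,
      (-(relRun pol sch c x₀ i).received * holdingTime (c i) (relRun pol sch c x₀ i).mode
        + holdingTime (c i) (relRun pol sch c x₀ i).mode ^ 2 / 2
        - a * holdingTime (c i) (relRun pol sch c x₀ i).mode)) / (n : ℝ)) atTop (𝓝 0))
    (hY : ∀ n, |(relRun pol sch c x₀ n).received| * holdingTime (c n) (relRun pol sch c x₀ n).mode
        + holdingTime (c n) (relRun pol sch c x₀ n).mode ^ 2 / 2
        + |a| * holdingTime (c n) (relRun pol sch c x₀ n).mode ≤ Y n)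
    (hYlim : Tendsto (fun n : ℕ => Y n / n) atTop (𝓝 0))
    (hδ : 0 < δ) (hlin : ∀ᶠ n : ℕ in atTop, δ * n ≤ (run pol sch c x₀ n).1) :
    IsTimeAverage (age pol sch c x₀) a := by
  have hH : ∀ n, (run pol sch c x₀ (n + 1)).1 - (run pol sch c x₀ n).1
      = holdingTime (c n) (relRun pol sch c x₀ n).mode := fun n => by rw [run_succ_fst]; ring
  refine isTimeAverage_of_sawtooth (T := fun n => (run pol sch c x₀ n).1)
    (r := fun n => (run pol sch c x₀ n).2.received) (Y := Y) (by rfl) (strictMono_run_fst hc)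
    (fun n t ht => ?_) ?_ (fun n => ?_) hYlim hδ hlin
  · rw [age, stateAt, eventCount_eq hc ht]
  · simpa only [hH, run_fst_sub_received] using hsum
  · simpa only [hH, run_fst_sub_received, abs_neg] using hY n

end Run

/-! ### Bounds on the state seen from the current time -/

/-- All three clocks are positive; this holds almost surely under `clockLaw`. -/
def Clocks.Pos (c : Clocks) : Prop := 0 < c.arr ∧ 0 < c.wait ∧ 0 < c.trans

theorem Clocks.Pos.holdingTime_pos {c : Clocks} (hc : c.Pos) (m : Mode) : 0 < holdingTime c m := by
  obtain ⟨h1, h2, h3⟩ := hc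
  cases m <;> simp [holdingTime, *]

theorem holdingTime_le_arr (c : Clocks) (m : Mode) : holdingTime c m ≤ c.arr := by
  cases m <;> simp [holdingTime]

theorem min_le_holdingTime (c : Clocks) (m : Mode) :
    min c.arr (min c.wait c.trans) ≤ holdingTime c m := by
  cases m <;> simp [holdingTime]

/-- The larger of the absolute ages of the received and the stored packet. -/
def DeviceState.size (y : DeviceState) : ℝ := max |y.received| |y.stored|

theorem DeviceState.size_nonneg (y : DeviceState) : 0 ≤ y.size :=
  (abs_nonneg _).trans (le_max_left _ _)

theorem size_update_le (pol : Policy) (sch : Scheme) (e : Event) (y : DeviceState) :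
    (update pol sch 0 e y).size ≤ y.size := by
  obtain ⟨m, r, s⟩ := y
  cases m <;> cases e <;> cases sch <;> simp [update, DeviceState.size]

theorem size_shift_le {h : ℝ} (hh : 0 ≤ h) (y : DeviceState) : (y.shift h).size ≤ y.size + h := by
  have key : ∀ x : ℝ, |x - h| ≤ |x| + h := fun x => by
    simpa [abs_of_nonneg hh] using abs_sub x h
  refine max_le ((key _).trans ?_) ((key _).trans ?_)
  · exact add_le_add_left (le_max_left _ _) _
  · exact add_le_add_left (le_max_right _ _) _

theorem size_relStep_le (pol : Policy) (sch : Scheme) (y : DeviceState) {c : Clocks} (hc : c.Pos) :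
    (relStep pol sch y c).size ≤ y.size + c.arr :=
  (size_update_le _ _ _ _).trans <| (size_shift_le (hc.holdingTime_pos _).le y).trans <|
    by gcongr; exact holdingTime_le_arr _ _

/-- Clocks for which a waiting device gets access and a serving device succeeds, before the next
arrival. Comparing each clock with the constant `1` makes this a product set. -/
def Clocks.Good (c : Clocks) : Prop := 1 < c.arr ∧ c.wait ≤ 1 ∧ c.trans ≤ 1 ∧ c.ok = true

theorem relStep_idle (pol : Policy) (sch : Scheme) (r s : ℝ) (c : Clocks) :
    relStep pol sch ⟨.idle, r, s⟩ c = ⟨.waiting, r - c.arr, 0⟩ := rfl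

theorem Clocks.Good.relStep_waiting {c : Clocks} (hc : c.Good) (pol : Policy) (sch : Scheme)
    (r s : ℝ) : relStep pol sch ⟨.waiting, r, s⟩ c = ⟨.service, r - c.wait, s - c.wait⟩ := by
  obtain ⟨h1, h2, h3, h4⟩ := hc
  have : c.wait < c.arr := by linarith
  simp [relStep, nextEvent, holdingTime, update, DeviceState.shift, not_le.2 this, this.le]

theorem Clocks.Good.relStep_service {c : Clocks} (hc : c.Good) (pol : Policy) (sch : Scheme)
    (r s : ℝ) : relStep pol sch ⟨.service, r, s⟩ c = ⟨.idle, s - c.trans, s - c.trans⟩ := by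
  obtain ⟨h1, h2, h3, h4⟩ := hc
  have : c.trans < c.arr := by linarith
  simp [relStep, nextEvent, holdingTime, update, DeviceState.shift, not_le.2 this, this.le, h4]

/-- Five good jumps in a row include the generation and the delivery of a packet, whatever the
initial mode. So the state forgets its past. -/
theorem size_five_good_le (pol : Policy) (sch : Scheme) (y : DeviceState) {c : Fin 5 → Clocks}
    (hpos : ∀ i, (c i).Pos) (hgood : ∀ i, (c i).Good) :
    (relStep pol sch (relStep pol sch (relStep pol sch (relStep pol sch
      (relStep pol sch y (c 0)) (c 1)) (c 2)) (c 3)) (c 4)).size ≤ ∑ i, (c i).arr := by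
  have hb : ∀ i, 0 < (c i).arr ∧ 0 < (c i).wait ∧ 0 < (c i).trans ∧ (c i).wait < (c i).arr
      ∧ (c i).trans < (c i).arr := fun i =>
    ⟨(hpos i).1, (hpos i).2.1, (hpos i).2.2, by linarith [(hgood i).1, (hgood i).2.1],
      by linarith [(hgood i).1, (hgood i).2.2.1]⟩
  obtain ⟨a0, w0, t0, u0, v0⟩ := hb 0
  obtain ⟨a1, w1, t1, u1, v1⟩ := hb 1
  obtain ⟨a2, w2, t2, u2, v2⟩ := hb 2
  obtain ⟨a3, w3, t3, u3, v3⟩ := hb 3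
  obtain ⟨a4, w4, t4, u4, v4⟩ := hb 4
  obtain ⟨m, r, s⟩ := y
  rw [Fin.sum_univ_five]
  cases m <;> simp only [relStep_idle, (hgood _).relStep_waiting, (hgood _).relStep_service,
    DeviceState.size] <;> refine max_le (abs_le.2 ⟨?_, ?_⟩) (abs_le.2 ⟨?_, ?_⟩) <;> linarith

/-! ### Measurability -/

instance : MeasurableSpace Mode := ⊤
instance : DiscreteMeasurableSpace Mode := ⟨fun _ => trivial⟩
instance : MeasurableSpace Event := ⊤
instance : DiscreteMeasurableSpace Event := ⟨fun _ => trivial⟩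
instance : Countable Event := by
  refine Function.Injective.countable (β := Fin 4) (f := fun e => match e with
    | .arrival => 0 | .access => 1 | .success => 2 | .failure => 3) ?_
  intro e e' h
  cases e <;> cases e' <;> simp_all

/-- The σ-algebra of `Mode × ℝ × ℝ`. -/
instance : MeasurableSpace DeviceState :=
  MeasurableSpace.comap (fun x => (x.mode, x.received, x.stored)) inferInstance

section Measurability

variable {α : Type*} [MeasurableSpace α]

theorem measurable_deviceState_iff {f : α → DeviceState} : Measurable f ↔
    Measurable (fun a => (f a).mode) ∧ Measurable (fun a => (f a).received) ∧
      Measurable (fun a => (f a).stored) := by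
  rw [measurable_comap_iff]
  refine ⟨fun h => ⟨h.fst, h.snd.fst, h.snd.snd⟩, fun h => h.1.prodMk (h.2.1.prodMk h.2.2)⟩

theorem measurable_mode : Measurable DeviceState.mode :=
  (measurable_deviceState_iff.1 measurable_id).1

theorem measurable_received : Measurable DeviceState.received :=
  (measurable_deviceState_iff.1 measurable_id).2.1

theorem measurable_stored : Measurable DeviceState.stored :=
  (measurable_deviceState_iff.1 measurable_id).2.2

theorem measurable_size : Measurable DeviceState.size :=
  (measurable_received.norm).max (measurable_stored.norm)

theorem measurable_arr : Measurable Clocks.arr := measurable_fst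
theorem measurable_wait : Measurable Clocks.wait := measurable_snd.fst
theorem measurable_trans : Measurable Clocks.trans := measurable_snd.snd.fst
theorem measurable_ok : Measurable Clocks.ok := measurable_snd.snd.snd

/-- A function is measurable if it is measurable for each value of a discrete parameter. -/
theorem measurable_of_discrete {ι β : Type*} [MeasurableSpace ι] [DiscreteMeasurableSpace ι]
    [Countable ι] [MeasurableSpace β] {g : ι → α → β} {m : α → ι} (hg : ∀ i, Measurable (g i))
    (hm : Measurable m) : Measurable fun a => g (m a) a := by
  have : Measurable fun p : ι × α => g p.1 p.2 := measurable_from_prod_countable_right hg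
  exact this.comp (hm.prodMk measurable_id)

theorem measurable_holdingTime {m : α → Mode} {c : α → Clocks} (hm : Measurable m)
    (hc : Measurable c) : Measurable fun a => holdingTime (c a) (m a) := by
  refine measurable_of_discrete (g := fun m a => holdingTime (c a) m) (fun i => ?_) hm
  have h1 := measurable_arr.comp hc
  have h2 := measurable_wait.comp hc
  have h3 := measurable_trans.comp hc
  cases i
  · exact h1
  · exact h1.min h2
  · exact h1.min h3

theorem measurable_nextEvent {m : α → Mode} {c : α → Clocks} (hm : Measurable m)
    (hc : Measurable c) : Measurable fun a => nextEvent (c a) (m a) := by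
  refine measurable_of_discrete (g := fun m a => nextEvent (c a) m) (fun i => ?_) hm
  have h1 := measurable_arr.comp hc
  have h2 := measurable_wait.comp hc
  have h3 := measurable_trans.comp hc
  have h4 := measurable_ok.comp hc
  cases i
  · exact measurable_const
  · exact Measurable.ite (measurableSet_le h1 h2) measurable_const measurable_const
  · exact Measurable.ite (measurableSet_le h1 h3) measurable_const
      (Measurable.ite (h4 (measurableSet_singleton true)) measurable_const measurable_const)

theorem measurable_relStep {pol : Policy} {sch : Scheme} {y : α → DeviceState} {c : α → Clocks}
    (hy : Measurable y) (hc : Measurable c) : Measurable fun a => relStep pol sch (y a) (c a) := by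
  have hm := measurable_mode.comp hy
  have hr := measurable_received.comp hy
  have hs := measurable_stored.comp hy
  have hH := measurable_holdingTime hm hc
  have hz : Measurable fun a => (y a).shift (holdingTime (c a) (y a).mode) :=
    measurable_deviceState_iff.2 ⟨hm, hr.sub hH, hs.sub hH⟩
  have hupd : ∀ e : Event, Measurable fun x : DeviceState => update pol sch 0 e x := by
    intro e
    refine measurable_of_discrete (g := fun m x => update pol sch 0 e ⟨m, x.received, x.stored⟩)
      (fun m => ?_) measurable_mode
    rw [measurable_deviceState_iff]
    cases m <;> cases e <;> cases sch <;>
      simp [update, measurable_received, measurable_stored]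
  exact measurable_of_discrete
    (g := fun e a => update pol sch 0 e ((y a).shift (holdingTime (c a) (y a).mode)))
    (fun e => (hupd e).comp hz) (measurable_nextEvent hm hc)

theorem measurableSet_good : MeasurableSet {c : Clocks | c.Good} :=
  (measurableSet_lt measurable_const measurable_arr).inter <|
    (measurableSet_le measurable_wait measurable_const).inter <|
    (measurableSet_le measurable_trans measurable_const).inter <|
    measurable_ok (measurableSet_singleton true)

end Measurability

/-! ### The law of one input -/

section Law

variable {lam k μ : ℝ} {p : unitInterval}

theorem isProbabilityMeasure_clockLaw (hlam : 0 < lam) (hk : 0 < k) (hμ : 0 < μ) :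
    IsProbabilityMeasure (clockLaw lam k μ p) := by
  have := isProbabilityMeasure_expMeasure hlam
  have := isProbabilityMeasure_expMeasure hk
  have := isProbabilityMeasure_expMeasure hμ
  unfold clockLaw
  infer_instance

theorem ae_pos_clockLaw (hlam : 0 < lam) (hk : 0 < k) (hμ : 0 < μ) :
    ∀ᵐ c ∂(clockLaw lam k μ p), c.Pos := by
  have := isProbabilityMeasure_expMeasure hlam
  have := isProbabilityMeasure_expMeasure hk
  have := isProbabilityMeasure_expMeasure hμ
  have h1 : ∀ᵐ c ∂(clockLaw lam k μ p), 0 < c.1 :=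
    Measure.quasiMeasurePreserving_fst.ae (ae_pos_expMeasure lam)
  have h2 : ∀ᵐ c ∂(clockLaw lam k μ p), 0 < c.2.1 :=
    Measure.quasiMeasurePreserving_snd.ae
      (Measure.quasiMeasurePreserving_fst.ae (ae_pos_expMeasure k))
  have h3 : ∀ᵐ c ∂(clockLaw lam k μ p), 0 < c.2.2.1 :=
    Measure.quasiMeasurePreserving_snd.ae (Measure.quasiMeasurePreserving_snd.ae
      (Measure.quasiMeasurePreserving_fst.ae (ae_pos_expMeasure μ)))
  filter_upwards [h1, h2, h3] with c h1 h2 h3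
  exact ⟨h1, h2, h3⟩

theorem clockLaw_real_good_pos (hlam : 0 < lam) (hk : 0 < k) (hμ : 0 < μ) (hp : 0 < (p : ℝ)) :
    0 < (clockLaw lam k μ p).real {c | c.Good} := by
  have := isProbabilityMeasure_expMeasure hlam
  have := isProbabilityMeasure_expMeasure hk
  have := isProbabilityMeasure_expMeasure hμ
  have e : {c : Clocks | c.Good} = Set.Ioi 1 ×ˢ (Set.Iic 1 ×ˢ (Set.Iic 1 ×ˢ {true})) := by
    ext c; rfl
  have hIic : ∀ {r : ℝ}, 0 < r → 0 < (expMeasure r).real (Set.Iic 1) := by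
    intro r hr
    have := isProbabilityMeasure_expMeasure hr
    rw [← cdf_eq_real, cdf_expMeasure_eq hr, if_pos zero_le_one]
    simpa using hr
  rw [e, clockLaw, measureReal_prod_prod, measureReal_prod_prod, measureReal_prod_prod,
    expMeasure_real_Ioi hlam zero_le_one]
  have hb : 0 < (bernoulliMeasure true false p).real {true} := by
    simpa [bernoulliMeasure_real_apply] using hp
  have := hIic hk
  have := hIic hμ
  positivity

theorem integral_arr_clockLaw (hlam : 0 < lam) (hk : 0 < k) (hμ : 0 < μ) {f : ℝ → ℝ}
    (hf : Integrable f (expMeasure lam)) :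
    Integrable (fun c : Clocks => f c.arr) (clockLaw lam k μ p) ∧
    ∫ c, f c.arr ∂(clockLaw lam k μ p) = ∫ x, f x ∂(expMeasure lam) := by
  have := isProbabilityMeasure_expMeasure hlam
  have := isProbabilityMeasure_expMeasure hk
  have := isProbabilityMeasure_expMeasure hμ
  refine ⟨hf.comp_fst _, ?_⟩
  have := integral_fun_fst (μ := expMeasure lam)
    (ν := (expMeasure k).prod ((expMeasure μ).prod (bernoulliMeasure true false p))) f
  rw [probReal_univ, one_smul] at this
  exact this

theorem integrable_one_add_arr_pow (hlam : 0 < lam) (hk : 0 < k) (hμ : 0 < μ) (n : ℕ) :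
    Integrable (fun c : Clocks => (1 + c.arr) ^ n) (clockLaw lam k μ p) := by
  refine (integral_arr_clockLaw (f := fun x => (1 + x) ^ n) hlam hk hμ ?_).1
  simp_rw [add_comm (1 : ℝ), add_pow]
  refine integrable_finsetSum _ fun i _ => ?_
  simp only [one_pow, mul_one]
  exact (integrable_pow_expMeasure hlam i).mul_const _

end Law

/-! ### Second moments of the state -/

section Inputs

variable {Ω : Type*}

/-- The σ-algebra generated by the inputs of the first `n` jumps. -/
abbrev pastInputs (C : ℕ → Ω → Clocks) (n : ℕ) : MeasurableSpace Ω :=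
  ⨆ j ∈ Set.Iio n, MeasurableSpace.comap (C j) inferInstance

/-- The σ-algebra generated by the inputs of all jumps after the first `n`. -/
abbrev futureInputs (C : ℕ → Ω → Clocks) (n : ℕ) : MeasurableSpace Ω :=
  ⨆ j ∈ Set.Ici n, MeasurableSpace.comap (C j) inferInstance

variable {C : ℕ → Ω → Clocks}

theorem pastInputs_mono {i j : ℕ} (h : i ≤ j) : pastInputs C i ≤ pastInputs C j :=
  biSup_mono fun _ hk => lt_of_lt_of_le hk h

theorem measurable_pastInputs {i n : ℕ} (h : i < n) : Measurable[pastInputs C n] (C i) :=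
  Measurable.of_comap_le (le_iSup₂_of_le (f := fun j (_ : j ∈ Set.Iio n) =>
    MeasurableSpace.comap (C j) inferInstance) i h le_rfl)

theorem measurable_futureInputs {i n : ℕ} (h : n ≤ i) : Measurable[futureInputs C n] (C i) :=
  Measurable.of_comap_le (le_iSup₂_of_le (f := fun j (_ : j ∈ Set.Ici n) =>
    MeasurableSpace.comap (C j) inferInstance) i h le_rfl)

theorem measurable_relRun (pol : Policy) (sch : Scheme) (y₀ : DeviceState) (n : ℕ) :
    Measurable[pastInputs C n] fun ω => relRun pol sch (fun j => C j ω) y₀ n := by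
  induction n with
  | zero => exact @measurable_const _ _ _ (pastInputs C 0) _
  | succ n ih =>
    exact @measurable_relStep Ω (pastInputs C (n + 1)) pol sch _ _
      (ih.mono (pastInputs_mono n.le_succ) le_rfl) (measurable_pastInputs n.lt_succ_self)

end Inputs

section StateMoments

variable {Ω : Type*} [mΩ : MeasurableSpace Ω] {P : Measure Ω}
  {lam k μ : ℝ} {p : unitInterval} {C : ℕ → Ω → Clocks}

theorem pastInputs_le (hm : ∀ n, Measurable (C n)) (n : ℕ) : pastInputs C n ≤ mΩ :=
  iSup₂_le fun j _ => (hm j).comap_le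

theorem IsClockSequence.indep_past_future (hC : IsClockSequence P lam k μ p C)
    (hm : ∀ n, Measurable (C n)) (n : ℕ) : Indep (pastInputs C n) (futureInputs C n) P :=
  indep_iSup_of_disjoint (fun j => (hm j).comap_le) hC.indep
    (Set.disjoint_left.2 fun j (h : j < n) (h' : n ≤ j) => (not_lt.2 h') h)

theorem IsClockSequence.indepFun_past_future (hC : IsClockSequence P lam k μ p C)
    (hm : ∀ n, Measurable (C n)) {n : ℕ} {β γ : Type*} [MeasurableSpace β] [MeasurableSpace γ]
    {X : Ω → β} {Y : Ω → γ} (hX : Measurable[pastInputs C n] X)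
    (hY : Measurable[futureInputs C n] Y) : IndepFun X Y P :=
  indep_of_indep_of_le (hC.indep_past_future hm n) hX.comap_le hY.comap_le

theorem IsClockSequence.ae_pos (hC : IsClockSequence P lam k μ p C)
    (hlam : 0 < lam) (hk : 0 < k) (hμ : 0 < μ) : ∀ᵐ ω ∂P, ∀ n, (C n ω).Pos :=
  ae_all_iff.2 fun n => by
    refine ae_of_ae_map (hC.law n).aemeasurable ?_
    rw [(hC.law n).map_eq]
    exact ae_pos_clockLaw hlam hk hμ

theorem IsClockSequence.integrable_comp (hC : IsClockSequence P lam k μ p C) (n : ℕ)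
    {f : Clocks → ℝ} (hf : Integrable f (clockLaw lam k μ p)) :
    Integrable (fun ω => f (C n ω)) P ∧
      ∫ ω, f (C n ω) ∂P = ∫ c, f c ∂(clockLaw lam k μ p) := by
  refine ⟨?_, (hC.law n).integral_comp hf.aestronglyMeasurable⟩
  rw [← (hC.law n).map_eq] at hf
  exact hf.comp_aemeasurable (hC.law n).aemeasurable

/-- An affine recursion with contraction factor `r < 1` and step five stays bounded. -/
theorem exists_bound_of_contraction {u : ℕ → ℝ} {r K : ℝ} (hr0 : 0 ≤ r) (hr1 : r < 1)
    (h : ∀ n, u (n + 5) ≤ r * u n + K) : ∃ B, ∀ n, u n ≤ B := by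
  have h1 : 0 < 1 - r := by linarith
  refine ⟨|u 0| + |u 1| + |u 2| + |u 3| + |u 4| + |K| / (1 - r), fun n => ?_⟩
  have h2 : 0 ≤ |K| / (1 - r) := by positivity
  induction n using Nat.strong_induction_on with
  | _ n ih =>
    by_cases hn : n < 5
    · have := abs_nonneg (u 0)
      have := abs_nonneg (u 1)
      have := abs_nonneg (u 2)
      have := abs_nonneg (u 3)
      have := abs_nonneg (u 4)
      have := le_abs_self (u n)
      interval_cases n <;> linarith
    · obtain ⟨m, rfl⟩ : ∃ m, n = m + 5 := ⟨n - 5, by omega⟩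
      set A := |u 0| + |u 1| + |u 2| + |u 3| + |u 4| with hA
      have hA0 : 0 ≤ A := by positivity
      have h3 : (1 - r) * (|K| / (1 - r)) = |K| := by field_simp
      have h4 := mul_le_mul_of_nonneg_left (ih m (by omega)) hr0
      have h5 : 0 ≤ (1 - r) * A := by positivity
      nlinarith [h m, le_abs_self K]

section Moments

variable (hC : IsClockSequence P lam k μ p C) (hm : ∀ n, Measurable (C n))
  (hlam : 0 < lam) (hk : 0 < k) (hμ : 0 < μ)

include hC hm hlam hk hμ

theorem IsClockSequence.memLp_one_add_arr (n : ℕ) :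
    MemLp (fun ω => 1 + (C n ω).arr) 2 P := by
  have h : AEStronglyMeasurable (fun ω => 1 + (C n ω).arr) P :=
    (measurable_const.add (measurable_arr.comp (hm n))).aestronglyMeasurable
  rw [memLp_two_iff_integrable_sq h]
  exact (hC.integrable_comp n (integrable_one_add_arr_pow hlam hk hμ 2)).1

variable [IsProbabilityMeasure P]

theorem IsClockSequence.memLp_arr (n : ℕ) : MemLp (fun ω => (C n ω).arr) 2 P := by
  have h := (hC.memLp_one_add_arr hm hlam hk hμ n).sub (memLp_const 1)
  exact h.ae_eq (ae_of_all _ fun ω => by simp)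

theorem IsClockSequence.memLp_size (pol : Policy) (sch : Scheme) (y₀ : DeviceState) (n : ℕ) :
    MemLp (fun ω => (relRun pol sch (fun j => C j ω) y₀ n).size) 2 P := by
  induction n with
  | zero => exact (memLp_const y₀.size : MemLp (fun _ : Ω => y₀.size) 2 P)
  | succ n ih =>
    refine (ih.add (hC.memLp_arr hm hlam hk hμ n)).mono
      (measurable_size.comp ((measurable_relRun pol sch y₀ (n + 1)).mono
        (pastInputs_le hm _) le_rfl)).aestronglyMeasurable ?_
    filter_upwards [hC.ae_pos hlam hk hμ] with ω hω
    rw [Real.norm_of_nonneg (DeviceState.size_nonneg _)]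
    exact (size_relStep_le pol sch _ (hω n)).trans (le_abs_self _)

theorem IsClockSequence.exists_integral_size_sq_le (hp : 0 < (p : ℝ)) (pol : Policy) (sch : Scheme)
    (y₀ : DeviceState) :
    ∃ K, ∀ n, ∫ ω, (relRun pol sch (fun j => C j ω) y₀ n).size ^ 2 ∂P ≤ K := by
  set V : ℕ → Ω → ℝ := fun n ω => (relRun pol sch (fun j => C j ω) y₀ n).size with hV
  have hVL : ∀ n, MemLp (V n) 2 P := hC.memLp_size hm hlam hk hμ pol sch y₀
  have hV0 : ∀ n ω, 0 ≤ V n ω := fun n ω => DeviceState.size_nonneg _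
  set q := (clockLaw lam k μ p).real {c | c.Good}
  have hq : 0 < q := clockLaw_real_good_pos hlam hk hμ hp
  -- the event that five jumps after the `n`-th are all good
  set A : ℕ → Set Ω := fun n => ⋂ i ∈ Finset.Ico n (n + 5), C i ⁻¹' {c | c.Good} with hA
  have hAf : ∀ n, MeasurableSet[futureInputs C n] (A n) := fun n =>
    Finset.measurableSet_biInter _ fun i hi =>
      measurable_futureInputs (Finset.mem_Ico.1 hi).1 measurableSet_good
  have hAm : ∀ n, MeasurableSet (A n) := fun n =>
    Finset.measurableSet_biInter _ fun i _ => hm i measurableSet_good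
  have hPA : ∀ n, P.real (A n) = q ^ 5 := by
    intro n
    have h := hC.indep.measure_inter_preimage_eq_mul (S := Finset.Ico n (n + 5))
      (sets := fun _ => {c : Clocks | c.Good}) (fun _ _ => measurableSet_good)
    rw [measureReal_def, hA]
    simp only
    rw [h, ENNReal.toReal_prod]
    have h2 : ∀ i, (P (C i ⁻¹' {c | c.Good})).toReal = q := fun i =>
      (hC.law i).measureReal_eq measurableSet_good
    rw [Finset.prod_congr rfl fun i _ => h2 i]
    simp
  have hq5 : q ^ 5 ≤ 1 := (hPA 0) ▸ measureReal_le_one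
  have hq5' : 0 < q ^ 5 := by positivity
  set bad : ℕ → Ω → ℝ := fun n => (A n)ᶜ.indicator 1 with hbad
  have hbadint : ∀ n, ∫ ω, bad n ω ∂P = 1 - q ^ 5 := fun n => by
    rw [hbad, integral_indicator_one (hAm n).compl, measureReal_compl (hAm n), hPA]
    simp
  set S : ℕ → Ω → ℝ := fun n ω => ∑ i : Fin 5, (C (n + i) ω).arr with hS
  have hrec : ∀ n, ∀ᵐ ω ∂P, V (n + 5) ω ≤ bad n ω * V n ω + S n ω := by
    intro n
    filter_upwards [hC.ae_pos hlam hk hμ] with ω hω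
    by_cases h : ω ∈ A n
    · have hg : ∀ i : Fin 5, (C (n + i) ω).Good := fun i => by
        have := Set.mem_iInter₂.1 h (n + i) (by simp)
        exact this
      simp only [hbad, Set.indicator, Set.mem_compl_iff, h, not_true, if_false, zero_mul, zero_add]
      exact size_five_good_le pol sch _ (c := fun i : Fin 5 => C (n + i) ω) (fun i => hω _) hg
    · simp only [hbad, Set.indicator, Set.mem_compl_iff, h, not_false_iff, if_true, Pi.one_apply,
        one_mul, hS, Fin.sum_univ_five]
      have h1 := fun i => size_relStep_le pol sch (relRun pol sch (fun j => C j ω) y₀ i) (hω i)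
      have h0 := h1 n
      have h2 := h1 (n + 1)
      have h3 := h1 (n + 2)
      have h4 := h1 (n + 3)
      have h5 := h1 (n + 4)
      simp only [hV]
      change (relStep pol sch (relRun pol sch (fun j => C j ω) y₀ (n + 4)) (C (n + 4) ω)).size ≤ _
      simp only [relRun] at *
      simp only [Fin.val_zero, Fin.val_one, Fin.val_two, add_zero]
      norm_num
      linarith
  set M := ∫ c : Clocks, c.arr ^ 2 ∂(clockLaw lam k μ p) with hM
  have hSL : ∀ n, MemLp (S n) 2 P := fun n =>
    memLp_finsetSum _ fun i _ => hC.memLp_arr hm hlam hk hμ _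
  have hSint : ∀ n, ∫ ω, S n ω ^ 2 ∂P ≤ 25 * M := by
    intro n
    calc ∫ ω, S n ω ^ 2 ∂P ≤ ∫ ω, 5 * ∑ i : Fin 5, (C (n + i) ω).arr ^ 2 ∂P := by
          refine integral_mono (hSL n).integrable_sq ((integrable_finsetSum _ fun i _ =>
            (hC.memLp_arr hm hlam hk hμ _).integrable_sq).const_mul _) fun ω => ?_
          simpa using sq_sum_le_card_mul_sum_sq (s := (Finset.univ : Finset (Fin 5)))
            (f := fun i => (C (n + i) ω).arr)
      _ = 5 * ∑ i : Fin 5, ∫ ω, (C (n + i) ω).arr ^ 2 ∂P := by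
          rw [integral_const_mul, integral_finsetSum _ fun i _ =>
            (hC.memLp_arr hm hlam hk hμ _).integrable_sq]
      _ = 25 * M := by
          have : ∀ i, ∫ ω, (C i ω).arr ^ 2 ∂P = M := fun i =>
            (hC.integrable_comp i (f := fun c => c.arr ^ 2) (integral_arr_clockLaw
              (f := fun x => x ^ 2) hlam hk hμ (integrable_pow_expMeasure hlam 2)).1).2
          simp [this]
          ring
  -- `ε` is chosen such that `(1 + ε) * (1 - q ^ 5) < 1`
  set ρ := 1 - q ^ 5 with hρ
  set ε := q ^ 5 / 2 with hε
  have hε0 : 0 < ε := by positivity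
  refine exists_bound_of_contraction (r := (1 + ε) * ρ) (K := (1 + ε⁻¹) * (25 * M))
    (mul_nonneg (by positivity) (by linarith)) (by nlinarith) fun n => ?_
  have hind : IndepFun (fun ω => V n ω ^ 2) (bad n) P :=
    hC.indepFun_past_future hm (n := n)
      ((@Measurable.comp _ _ _ (pastInputs C n) _ _ _ _ measurable_size
        (measurable_relRun pol sch y₀ n)).pow_const 2)
      ((@measurable_const _ _ _ (futureInputs C n) (1 : ℝ)).indicator (hAf n).compl)
  have hbadI : Integrable (bad n) P := (integrable_const 1).indicator (hAm n).compl
  have hprodI : Integrable (fun ω => V n ω ^ 2 * bad n ω) P :=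
    hind.integrable_mul (hVL n).integrable_sq hbadI
  have hprod : ∫ ω, V n ω ^ 2 * bad n ω ∂P = (∫ ω, V n ω ^ 2 ∂P) * ρ := by
    rw [hind.integral_fun_mul_eq_mul_integral (hVL n).integrable_sq.aestronglyMeasurable
      hbadI.aestronglyMeasurable, hbadint]
  calc ∫ ω, V (n + 5) ω ^ 2 ∂P
      ≤ ∫ ω, (1 + ε) * (V n ω ^ 2 * bad n ω) + (1 + ε⁻¹) * S n ω ^ 2 ∂P := by
        refine integral_mono_ae (hVL _).integrable_sq ((hprodI.const_mul _).add
          ((hSL n).integrable_sq.const_mul _)) ?_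
        filter_upwards [hrec n] with ω hω
        have hb : bad n ω ^ 2 = bad n ω := by
          simp only [hbad, Set.indicator]; split_ifs <;> simp
        calc V (n + 5) ω ^ 2 ≤ (bad n ω * V n ω + S n ω) ^ 2 := by
              gcongr; exact hV0 _ _
          _ ≤ (1 + ε) * (bad n ω * V n ω) ^ 2 + (1 + ε⁻¹) * S n ω ^ 2 := by
              have h1 : 0 ≤ ε⁻¹ * (ε * (bad n ω * V n ω) - S n ω) ^ 2 := by positivity
              have h2 : ε⁻¹ * (ε * (bad n ω * V n ω) - S n ω) ^ 2
                  = ε * (bad n ω * V n ω) ^ 2 - 2 * (bad n ω * V n ω) * S n ω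
                    + ε⁻¹ * S n ω ^ 2 := by field_simp; ring
              nlinarith
          _ = _ := by rw [mul_pow, hb]; ring
    _ = (1 + ε) * ρ * ∫ ω, V n ω ^ 2 ∂P + (1 + ε⁻¹) * ∫ ω, S n ω ^ 2 ∂P := by
        rw [integral_add (hprodI.const_mul _) ((hSL n).integrable_sq.const_mul _),
          integral_const_mul, integral_const_mul, hprod]
        ring
    _ ≤ _ := by
        gcongr
        exact hSint n

end Moments

end StateMoments

/-! ### Integrals over the input of one jump -/

section ClockIntegrals

variable {lam k μ : ℝ} {p : unitInterval}

theorem integral_comp_of_measurePreserving {α β : Type*} [MeasurableSpace α] [MeasurableSpace β]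
    {m : Measure α} {n : Measure β} {g : α → β} (hg : MeasurePreserving g m n) {F : β → ℝ}
    (hF : Integrable F n) :
    Integrable (fun x => F (g x)) m ∧ ∫ x, F (g x) ∂m = ∫ y, F y ∂n := by
  refine ⟨hg.integrable_comp_of_integrable hF, ?_⟩
  rw [← hg.map_eq, integral_map hg.measurable.aemeasurable]
  rw [hg.map_eq]
  exact hF.aestronglyMeasurable

/-- In the waiting mode the arrival clock competes with the access clock. -/
theorem integral_waiting_clockLaw (hlam : 0 < lam) (hk : 0 < k) (hμ : 0 < μ) {f g : ℝ → ℝ}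
    (hf : Integrable f (expMeasure lam)) (hg : Integrable g (expMeasure k)) :
    ∫ c : Clocks, (if c.arr ≤ c.wait then f c.arr else g c.wait) ∂(clockLaw lam k μ p)
      = lam / (lam + k) * ∫ x, f x ∂(expMeasure (lam + k))
        + k / (lam + k) * ∫ x, g x ∂(expMeasure (lam + k)) := by
  have := isProbabilityMeasure_expMeasure hlam
  have := isProbabilityMeasure_expMeasure hk
  have := isProbabilityMeasure_expMeasure hμ
  have hmp : MeasurePreserving (Prod.map id Prod.fst) (clockLaw lam k μ p)
      ((expMeasure lam).prod (expMeasure k)) :=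
    (MeasurePreserving.id _).prod measurePreserving_fst
  obtain ⟨h1, h2⟩ := integral_competing_clocks hlam hk hf hg
  rw [← h2, ← (integral_comp_of_measurePreserving hmp h1).2]
  rfl

/-- In the service mode the arrival clock competes with the transmission clock, and the outcome of a
transmission is independent of both. -/
theorem integral_service_clockLaw (hlam : 0 < lam) (hk : 0 < k) (hμ : 0 < μ) {f g h : ℝ → ℝ}
    (hf : Integrable f (expMeasure lam)) (hg : Integrable g (expMeasure μ))
    (hh : Integrable h (expMeasure μ)) :
    ∫ c : Clocks, (if c.arr ≤ c.trans then f c.arr else if c.ok then g c.trans else h c.trans)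
        ∂(clockLaw lam k μ p)
      = lam / (lam + μ) * ∫ x, f x ∂(expMeasure (lam + μ))
        + μ / (lam + μ) * (p * ∫ x, g x ∂(expMeasure (lam + μ))
          + (1 - p) * ∫ x, h x ∂(expMeasure (lam + μ))) := by
  have := isProbabilityMeasure_expMeasure hlam
  have := isProbabilityMeasure_expMeasure hk
  have := isProbabilityMeasure_expMeasure hμ
  have hmp : MeasurePreserving
      (fun c : Clocks => ((MeasurableEquiv.prodAssoc (α := ℝ) (β := ℝ) (γ := Bool)).symm
        (Prod.map id Prod.snd c)))
      (clockLaw lam k μ p)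
      (((expMeasure lam).prod (expMeasure μ)).prod (bernoulliMeasure true false p)) :=
    ((measurePreserving_prodAssoc _ _ _).symm _).comp
      ((MeasurePreserving.id _).prod measurePreserving_snd)
  obtain ⟨g1, g2⟩ := integral_competing_clocks hlam hμ hf hg
  obtain ⟨h1, h2⟩ := integral_competing_clocks hlam hμ hf hh
  have hb : ∀ φ : Bool → ℝ, Integrable φ (bernoulliMeasure true false p) := fun φ =>
    Integrable.of_finite
  have e : ∀ z : (ℝ × ℝ) × Bool,
      (if z.1.1 ≤ z.1.2 then f z.1.1 else if z.2 then g z.1.2 else h z.1.2)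
      = (if z.1.1 ≤ z.1.2 then f z.1.1 else g z.1.2) * (if z.2 then 1 else 0)
        + (if z.1.1 ≤ z.1.2 then f z.1.1 else h z.1.2) * (if z.2 then 0 else 1) := by
    rintro ⟨z, b⟩
    cases b <;> simp
  have i1 := g1.mul_prod (hb fun b => if b then 1 else 0)
  have i2 := h1.mul_prod (hb fun b => if b then 0 else 1)
  have key := integral_comp_of_measurePreserving hmp (i1.add i2)
  simp only [Pi.add_apply, ← e] at key
  refine Eq.trans key.2 ?_
  simp only [e]
  have j1 := integral_prod_mul (μ := (expMeasure lam).prod (expMeasure μ))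
    (ν := bernoulliMeasure true false p)
    (fun z : ℝ × ℝ => if z.1 ≤ z.2 then f z.1 else g z.2) (fun b => if b then (1 : ℝ) else 0)
  have j2 := integral_prod_mul (μ := (expMeasure lam).prod (expMeasure μ))
    (ν := bernoulliMeasure true false p)
    (fun z : ℝ × ℝ => if z.1 ≤ z.2 then f z.1 else h z.2) (fun b => if b then (0 : ℝ) else 1)
  refine (integral_add i1 i2).trans ((congrArg₂ (· + ·) j1 j2).trans ?_)
  rw [g2, h2, integral_bernoulliMeasure, integral_bernoulliMeasure]
  simp
  ring

end ClockIntegrals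

/-! ### The Poisson equation -/

/-- A function of the state that is affine in the ages of the received and of the stored packet,
with coefficients that depend on the mode. -/
structure Potential where
  /-- the constant term -/
  const : Mode → ℝ
  /-- the coefficient of the age of the received packet -/
  recv : Mode → ℝ
  /-- the coefficient of the age of the stored packet -/
  stor : Mode → ℝ

/-- The value at a state whose generation times are measured from the current time, so that the
ages are `-received` and `-stored`. -/
def Potential.val (φ : Potential) (y : DeviceState) : ℝ :=
  φ.const y.mode - φ.recv y.mode * y.received - φ.stor y.mode * y.stored

/-- The Poisson equation `𝓛 φ = a - age` of the Markov jump process, where the generator `𝓛` is the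
sum of the drift (both ages grow at rate one) and of the jumps with their rates. -/
structure Potential.IsPoissonSolution (φ : Potential) (lam k μ : ℝ) (p : unitInterval)
    (pol : Policy) (sch : Scheme) (a : ℝ) : Prop where
  idle : ∀ r s, lam * φ.val (update pol sch 0 .arrival ⟨.idle, r, s⟩)
    + (φ.recv .idle + φ.stor .idle) = a + r + lam * φ.val ⟨.idle, r, s⟩
  waiting : ∀ r s, lam * φ.val (update pol sch 0 .arrival ⟨.waiting, r, s⟩)
    + k * φ.val (update pol sch 0 .access ⟨.waiting, r, s⟩)
    + (φ.recv .waiting + φ.stor .waiting) = a + r + (lam + k) * φ.val ⟨.waiting, r, s⟩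
  service : ∀ r s, lam * φ.val (update pol sch 0 .arrival ⟨.service, r, s⟩)
    + μ * p * φ.val (update pol sch 0 .success ⟨.service, r, s⟩)
    + μ * (1 - p) * φ.val (update pol sch 0 .failure ⟨.service, r, s⟩)
    + (φ.recv .service + φ.stor .service) = a + r + (lam + μ) * φ.val ⟨.service, r, s⟩

/-- The excess of the integrated age over `a` times the duration, in one jump that takes time `h`
and ends with the event `e`, compensated by the increment of the potential. -/
def Potential.gain (φ : Potential) (pol : Policy) (sch : Scheme) (a : ℝ) (y : DeviceState)
    (e : Event) (h : ℝ) : ℝ :=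
  -y.received * h + h ^ 2 / 2 - a * h + φ.val (update pol sch 0 e (y.shift h)) - φ.val y

/-- `Potential.gain` as a function of the random input of the jump. -/
def Potential.jumpGain (φ : Potential) (pol : Policy) (sch : Scheme) (a : ℝ) (y : DeviceState)
    (c : Clocks) : ℝ :=
  φ.gain pol sch a y (nextEvent c y.mode) (holdingTime c y.mode)

namespace Potential

variable (φ : Potential) (pol : Policy) (sch : Scheme) (a : ℝ)

theorem val_shift (y : DeviceState) (h : ℝ) :
    φ.val (y.shift h) = φ.val y + (φ.recv y.mode + φ.stor y.mode) * h := by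
  simp only [val, DeviceState.shift]; ring

theorem exists_val_update_shift (e : Event) (y : DeviceState) : ∃ L, ∀ h,
    φ.val (update pol sch 0 e (y.shift h)) = φ.val (update pol sch 0 e y) + L * h := by
  refine ⟨φ.val (update pol sch 0 e (y.shift 1)) - φ.val (update pol sch 0 e y), fun h => ?_⟩
  obtain ⟨m, r, s⟩ := y
  cases m <;> cases e <;> cases sch <;> simp only [val, update, DeviceState.shift] <;> ring

/-- The expected gain when the duration is exponential. The quadratic term contributes `Λ⁻¹ ^ 2`,
and for the rest, which is affine, the duration may be replaced by its mean. -/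
theorem integral_gain (e : Event) (y : DeviceState) {Λ : ℝ} (hΛ : 0 < Λ) :
    Integrable (φ.gain pol sch a y e) (expMeasure Λ) ∧
    ∫ h, φ.gain pol sch a y e h ∂(expMeasure Λ) = -(y.received + a) * Λ⁻¹ + Λ⁻¹ ^ 2
      + φ.val (update pol sch 0 e (y.shift Λ⁻¹)) - φ.val y := by
  have := isProbabilityMeasure_expMeasure hΛ
  obtain ⟨L, hL⟩ := φ.exists_val_update_shift pol sch e y
  have e1 : φ.gain pol sch a y e = fun h => (φ.val (update pol sch 0 e y) - φ.val y)
      + (L - y.received - a) * h ^ 1 + (1 / 2) * h ^ 2 := by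
    ext h; rw [gain, hL]; ring
  have i0 : Integrable (fun _ : ℝ => φ.val (update pol sch 0 e y) - φ.val y) (expMeasure Λ) :=
    integrable_const _
  have i1 := (integrable_pow_expMeasure hΛ 1).const_mul (L - y.received - a)
  have i2 := (integrable_pow_expMeasure hΛ 2).const_mul (1 / 2)
  rw [e1]
  refine ⟨(i0.add i1).add i2, ?_⟩
  have i01 : Integrable (fun h : ℝ => (φ.val (update pol sch 0 e y) - φ.val y)
      + (L - y.received - a) * h ^ 1) (expMeasure Λ) := i0.add i1
  rw [integral_add i01 i2, integral_add i0 i1, integral_const_mul, integral_const_mul,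
    integral_pow_expMeasure hΛ, integral_pow_expMeasure hΛ, hL]
  simp [Nat.factorial]
  field_simp
  ring

/-- The Poisson equation makes the compensated gain of a jump centred, whatever the state. -/
theorem integral_jumpGain {lam k μ : ℝ} {p : unitInterval} {φ : Potential} {pol : Policy}
    {sch : Scheme} {a : ℝ} (hφ : φ.IsPoissonSolution lam k μ p pol sch a) (hlam : 0 < lam)
    (hk : 0 < k) (hμ : 0 < μ) (y : DeviceState) :
    ∫ c, φ.jumpGain pol sch a y c ∂(clockLaw lam k μ p) = 0 := by
  have hg := fun e (Λ : ℝ) (hΛ : 0 < Λ) => φ.integral_gain pol sch a e y hΛ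
  have hv := fun h => φ.val_shift y h
  obtain ⟨m, r, s⟩ := y
  cases m
  · have e : ∀ c : Clocks, φ.jumpGain pol sch a ⟨.idle, r, s⟩ c
        = φ.gain pol sch a ⟨.idle, r, s⟩ .arrival c.arr := fun c => rfl
    simp_rw [e]
    rw [(integral_arr_clockLaw hlam hk hμ (hg _ lam hlam).1).2, (hg _ lam hlam).2]
    -- the Poisson equation is used at the state reached after the mean holding time
    have h1 := hφ.idle (r - lam⁻¹) (s - lam⁻¹)
    have h2 := hv lam⁻¹
    simp only [DeviceState.shift] at h2 ⊢
    rw [h2] at h1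
    have h3 : lam * lam⁻¹ = 1 := mul_inv_cancel₀ hlam.ne'
    refine (mul_eq_zero.1 (?_ : lam * _ = 0)).resolve_left hlam.ne'
    linear_combination h1 + (-(r + a) + lam⁻¹ + (φ.recv .idle + φ.stor .idle)) * h3
  · have e : ∀ c : Clocks, φ.jumpGain pol sch a ⟨.waiting, r, s⟩ c
        = if c.arr ≤ c.wait then φ.gain pol sch a ⟨.waiting, r, s⟩ .arrival c.arr
          else φ.gain pol sch a ⟨.waiting, r, s⟩ .access c.wait := fun c => by
      by_cases h : c.arr ≤ c.wait
      · simp [jumpGain, nextEvent, holdingTime, h]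
      · simp [jumpGain, nextEvent, holdingTime, h, (not_le.1 h).le]
    have hΛ : 0 < lam + k := by positivity
    simp_rw [e]
    rw [integral_waiting_clockLaw hlam hk hμ (hg _ lam hlam).1 (hg _ k hk).1, (hg _ _ hΛ).2,
      (hg _ _ hΛ).2]
    have h1 := hφ.waiting (r - (lam + k)⁻¹) (s - (lam + k)⁻¹)
    have h2 := hv (lam + k)⁻¹
    simp only [DeviceState.shift] at h2 ⊢
    rw [h2] at h1
    simp only [div_eq_mul_inv]
    have h3 : (lam + k) * (lam + k)⁻¹ = 1 := mul_inv_cancel₀ hΛ.ne'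
    set Λ := (lam + k)⁻¹
    linear_combination Λ * h1 + (-(r + a) * Λ + Λ ^ 2
      + Λ * (φ.recv .waiting + φ.stor .waiting)) * h3
  · have e : ∀ c : Clocks, φ.jumpGain pol sch a ⟨.service, r, s⟩ c
        = if c.arr ≤ c.trans then φ.gain pol sch a ⟨.service, r, s⟩ .arrival c.arr
          else if c.ok then φ.gain pol sch a ⟨.service, r, s⟩ .success c.trans
          else φ.gain pol sch a ⟨.service, r, s⟩ .failure c.trans := fun c => by
      by_cases h : c.arr ≤ c.trans
      · simp [jumpGain, nextEvent, holdingTime, h]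
      · by_cases h' : c.ok <;> simp [jumpGain, nextEvent, holdingTime, h, h', (not_le.1 h).le]
    have hΛ : 0 < lam + μ := by positivity
    simp_rw [e]
    rw [integral_service_clockLaw hlam hk hμ (hg _ lam hlam).1 (hg _ μ hμ).1 (hg _ μ hμ).1,
      (hg _ _ hΛ).2, (hg _ _ hΛ).2, (hg _ _ hΛ).2]
    have h1 := hφ.service (r - (lam + μ)⁻¹) (s - (lam + μ)⁻¹)
    have h2 := hv (lam + μ)⁻¹
    simp only [DeviceState.shift] at h2 ⊢
    rw [h2] at h1
    simp only [div_eq_mul_inv]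
    have h3 : (lam + μ) * (lam + μ)⁻¹ = 1 := mul_inv_cancel₀ hΛ.ne'
    set Λ := (lam + μ)⁻¹
    linear_combination Λ * h1 + (-(r + a) * Λ + Λ ^ 2
      + Λ * (φ.recv .service + φ.stor .service)) * h3

end Potential

/-! ### Solutions of the Poisson equation

The potentials are normalised to vanish on idle states of age zero. The constants of the other two
modes then follow from the equations for the idle and the service mode, and the equation for the
waiting mode is the condition that determines `a`.
-/

/-- The rate at which the packet in service is preempted. -/
def Scheme.preemptionRate (lam : ℝ) : Scheme → ℝ
  | .WP => lam
  | .WOP => 0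

/-- Comparing coefficients turns the Poisson equation into a triangular linear system. -/
theorem Potential.isPoissonSolution_of_coefficients {φ : Potential} {lam k μ : ℝ} {p : unitInterval}
    {pol : Policy} {sch : Scheme} {a : ℝ}
    (hstor : φ.stor .idle = 0)
    (hrI : lam * (φ.recv .waiting - φ.recv .idle) = -1)
    (hrW : k * (φ.recv .service - φ.recv .waiting) = -1)
    (hrS : μ * (1 - p) * φ.recv pol.modeAfterFailure - μ * φ.recv .service = -1)
    (hsW : k * φ.stor .service = (lam + k) * φ.stor .waiting)
    (hsS : μ * p * φ.recv .idle + μ * (1 - p) * φ.stor pol.modeAfterFailure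
      = (μ + sch.preemptionRate lam) * φ.stor .service)
    (hcI : lam * φ.const .waiting + φ.recv .idle = a + lam * φ.const .idle)
    (hcW : k * φ.const .service + φ.recv .waiting + φ.stor .waiting = a + k * φ.const .waiting)
    (hcS : μ * p * φ.const .idle + μ * (1 - p) * φ.const pol.modeAfterFailure + φ.recv .service
      + φ.stor .service = a + μ * φ.const .service) :
    φ.IsPoissonSolution lam k μ p pol sch a := by
  refine ⟨fun r s => ?_, fun r s => ?_, fun r s => ?_⟩
  · simp only [val, update, hstor]
    linear_combination hcI - r * hrI
  · simp only [val, update]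
    linear_combination hcW - r * hrW - s * hsW
  · cases sch <;> simp only [val, update, hstor, Scheme.preemptionRate] at * <;>
      linear_combination hcS - r * hrS - s * hsS

section Solutions

variable {lam k μ : ℝ} {p : unitInterval}

theorem exists_isPoissonSolution_I_WP (hlam : 0 < lam) (hk : 0 < k) (hμ : 0 < μ)
    (hp : 0 < (p : ℝ)) : ∃ φ : Potential, φ.IsPoissonSolution lam k μ p .I .WP
      ((1 / lam + 1 / k + 1 / μ) * (1 / p) + (lam + k + μ) / ((lam + μ) * (lam + k))
        - (lam + k + μ) / (lam * k + k * μ + lam * μ)) := by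
  set a : ℝ := (1 / lam + 1 / k + 1 / μ) * (1 / p) + (lam + k + μ) / ((lam + μ) * (lam + k))
        - (lam + k + μ) / (lam * k + k * μ + lam * μ) with ha
  let αI := (1 / lam + 1 / k + 1 / μ) / (p : ℝ)
  let βS := μ * p * αI / (μ + lam)
  let βW := k * βS / (lam + k)
  refine ⟨⟨fun | .idle => 0 | .waiting => (a - αI) / lam
               | .service => (αI - 1 / lam - 1 / k + βS - a) / μ,
    fun | .idle => αI | .waiting => αI - 1 / lam | .service => αI - 1 / lam - 1 / k,
    fun | .idle => 0 | .waiting => βW | .service => βS⟩,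
    Potential.isPoissonSolution_of_coefficients rfl ?_ ?_ ?_ ?_ ?_ ?_ ?_ ?_⟩ <;>
  simp only [Policy.modeAfterFailure, Scheme.preemptionRate, βW, βS, αI, ha] <;> field_simp <;> ring

theorem exists_isPoissonSolution_I_WOP (hlam : 0 < lam) (hk : 0 < k) (hμ : 0 < μ)
    (hp : 0 < (p : ℝ)) : ∃ φ : Potential, φ.IsPoissonSolution lam k μ p .I .WOP
      ((1 / lam + 1 / k + 1 / μ) * (1 / p) + 1 / μ + 1 / (lam + k)
        - (lam + k + μ) / (lam * k + k * μ + lam * μ)) := by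
  set a : ℝ := (1 / lam + 1 / k + 1 / μ) * (1 / p) + 1 / μ + 1 / (lam + k)
        - (lam + k + μ) / (lam * k + k * μ + lam * μ) with ha
  let αI := (1 / lam + 1 / k + 1 / μ) / (p : ℝ)
  let βS := p * αI
  let βW := k * βS / (lam + k)
  refine ⟨⟨fun | .idle => 0 | .waiting => (a - αI) / lam
               | .service => (αI - 1 / lam - 1 / k + βS - a) / μ,
    fun | .idle => αI | .waiting => αI - 1 / lam | .service => αI - 1 / lam - 1 / k,
    fun | .idle => 0 | .waiting => βW | .service => βS⟩,
    Potential.isPoissonSolution_of_coefficients rfl ?_ ?_ ?_ ?_ ?_ ?_ ?_ ?_⟩ <;>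
  simp only [Policy.modeAfterFailure, Scheme.preemptionRate, βW, βS, αI, ha] <;> field_simp <;> ring

theorem exists_isPoissonSolution_W_WP (hlam : 0 < lam) (hk : 0 < k) (hμ : 0 < μ)
    (hp : 0 < (p : ℝ)) : ∃ φ : Potential, φ.IsPoissonSolution lam k μ p .W .WP
      ((p / lam + 1 / k + 1 / μ) * (1 / p)
        + (lam + k + μ) / ((lam + μ) * (k + lam) - k * μ * (1 - p))
        - (lam + k + μ) / (lam * k + lam * μ + k * μ * p)) := by
  have hD : (lam + μ) * (k + lam) - k * μ * (1 - p) = lam * (k + lam + μ) + k * μ * p := by ring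
  rw [hD]
  set a : ℝ := (p / lam + 1 / k + 1 / μ) * (1 / p)
        + (lam + k + μ) / (lam * (k + lam + μ) + k * μ * p)
        - (lam + k + μ) / (lam * k + lam * μ + k * μ * p) with ha
  let αI := (1 / k + 1 / μ) / (p : ℝ) + 1 / lam
  let βS := μ * p * αI * (lam + k) / (lam * (k + lam + μ) + k * μ * p)
  let βW := k * βS / (lam + k)
  refine ⟨⟨fun | .idle => 0 | .waiting => (a - αI) / lam
               | .service => (1 - p) * ((a - αI) / lam) + (αI - 1 / lam - 1 / k + βS - a) / μ,
    fun | .idle => αI | .waiting => αI - 1 / lam | .service => αI - 1 / lam - 1 / k,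
    fun | .idle => 0 | .waiting => βW | .service => βS⟩,
    Potential.isPoissonSolution_of_coefficients rfl ?_ ?_ ?_ ?_ ?_ ?_ ?_ ?_⟩ <;>
  simp only [Policy.modeAfterFailure, Scheme.preemptionRate, βW, βS, αI, ha] <;> field_simp <;> ring

theorem exists_isPoissonSolution_W_WOP (hlam : 0 < lam) (hk : 0 < k) (hμ : 0 < μ)
    (hp : 0 < (p : ℝ)) : ∃ φ : Potential, φ.IsPoissonSolution lam k μ p .W .WOP
      ((p / lam + 1 / k + 1 / μ) * (1 / p) + (lam + k + μ) / (μ * (k * p + lam))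
        - (lam + k + μ) / (lam * k + lam * μ + k * μ * p)) := by
  set a : ℝ := (p / lam + 1 / k + 1 / μ) * (1 / p) + (lam + k + μ) / (μ * (k * p + lam))
        - (lam + k + μ) / (lam * k + lam * μ + k * μ * p) with ha
  let αI := (1 / k + 1 / μ) / (p : ℝ) + 1 / lam
  let βS := p * αI * (lam + k) / (k * p + lam)
  let βW := k * βS / (lam + k)
  refine ⟨⟨fun | .idle => 0 | .waiting => (a - αI) / lam
               | .service => (1 - p) * ((a - αI) / lam) + (αI - 1 / lam - 1 / k + βS - a) / μ,
    fun | .idle => αI | .waiting => αI - 1 / lam | .service => αI - 1 / lam - 1 / k,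
    fun | .idle => 0 | .waiting => βW | .service => βS⟩,
    Potential.isPoissonSolution_of_coefficients rfl ?_ ?_ ?_ ?_ ?_ ?_ ?_ ?_⟩ <;>
  simp only [Policy.modeAfterFailure, Scheme.preemptionRate, βW, βS, αI, ha] <;> field_simp <;> ring

theorem exists_isPoissonSolution_S_WP (hlam : 0 < lam) (hk : 0 < k) (hμ : 0 < μ)
    (hp : 0 < (p : ℝ)) : ∃ φ : Potential, φ.IsPoissonSolution lam k μ p .S .WP
      (1 / lam + 1 / k + 1 / (μ * p) + (μ * p + k + lam) / ((lam + μ * p) * (lam + k))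
        - (lam + k + μ * p) / (lam * k + (k + lam) * (μ * p))) := by
  set a : ℝ := 1 / lam + 1 / k + 1 / (μ * p) + (μ * p + k + lam) / ((lam + μ * p) * (lam + k))
        - (lam + k + μ * p) / (lam * k + (k + lam) * (μ * p)) with ha
  let αI := 1 / (μ * p) + 1 / k + 1 / lam
  let βS := μ * p * αI / (lam + μ * p)
  let βW := k * βS / (lam + k)
  refine ⟨⟨fun | .idle => 0 | .waiting => (a - αI) / lam
               | .service => (αI - 1 / lam - 1 / k + βS - a) / (μ * p),
    fun | .idle => αI | .waiting => αI - 1 / lam | .service => αI - 1 / lam - 1 / k,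
    fun | .idle => 0 | .waiting => βW | .service => βS⟩,
    Potential.isPoissonSolution_of_coefficients rfl ?_ ?_ ?_ ?_ ?_ ?_ ?_ ?_⟩ <;>
  simp only [Policy.modeAfterFailure, Scheme.preemptionRate, βW, βS, αI, ha] <;> field_simp <;> ring

theorem exists_isPoissonSolution_S_WOP (hlam : 0 < lam) (hk : 0 < k) (hμ : 0 < μ)
    (hp : 0 < (p : ℝ)) : ∃ φ : Potential, φ.IsPoissonSolution lam k μ p .S .WOP
      (1 / lam + 1 / k + 2 / (μ * p) + 1 / (lam + k)
        - (lam + k + μ * p) / (lam * k + (k + lam) * (μ * p))) := by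
  set a : ℝ := 1 / lam + 1 / k + 2 / (μ * p) + 1 / (lam + k)
        - (lam + k + μ * p) / (lam * k + (k + lam) * (μ * p)) with ha
  let αI := 1 / (μ * p) + 1 / k + 1 / lam
  let βS := αI
  let βW := k * βS / (lam + k)
  refine ⟨⟨fun | .idle => 0 | .waiting => (a - αI) / lam
               | .service => (αI - 1 / lam - 1 / k + βS - a) / (μ * p),
    fun | .idle => αI | .waiting => αI - 1 / lam | .service => αI - 1 / lam - 1 / k,
    fun | .idle => 0 | .waiting => βW | .service => βS⟩,
    Potential.isPoissonSolution_of_coefficients rfl ?_ ?_ ?_ ?_ ?_ ?_ ?_ ?_⟩ <;>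
  simp only [Policy.modeAfterFailure, Scheme.preemptionRate, βW, βS, αI, ha] <;> field_simp <;> ring

end Solutions

/-! ### Dependence on the initial state -/

/-- The affine combination of three states with weights `1 - u - v`, `u`, `v`, in the mode of the
first one. -/
def DeviceState.comb (u v : ℝ) (x y z : DeviceState) : DeviceState :=
  ⟨x.mode, (1 - u - v) * x.received + u * y.received + v * z.received,
    (1 - u - v) * x.stored + u * y.stored + v * z.stored⟩

theorem update_comb (pol : Policy) (sch : Scheme) (t : ℝ) (e : Event) (u v : ℝ)
    {x y z : DeviceState} (hy : y.mode = x.mode) (hz : z.mode = x.mode) :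
    update pol sch t e (x.comb u v y z)
        = (update pol sch t e x).comb u v (update pol sch t e y) (update pol sch t e z) ∧
      (update pol sch t e y).mode = (update pol sch t e x).mode ∧
      (update pol sch t e z).mode = (update pol sch t e x).mode := by
  obtain ⟨m, r, s⟩ := x
  obtain ⟨m', r', s'⟩ := y
  obtain ⟨m'', r'', s''⟩ := z
  have hy' : m = m' := hy.symm
  have hz' : m = m'' := hz.symm
  subst hy' hz'
  have ht : t = (1 - u - v) * t + u * t + v * t := by ring
  cases m <;> cases e <;> cases sch <;> simp [update, DeviceState.comb, ← ht]

theorem run_comb (pol : Policy) (sch : Scheme) (c : ℕ → Clocks) (u v : ℝ) {x y z : DeviceState}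
    (hy : y.mode = x.mode) (hz : z.mode = x.mode) (n : ℕ) :
    (run pol sch c (x.comb u v y z) n = ((run pol sch c x n).1,
        (run pol sch c x n).2.comb u v (run pol sch c y n).2 (run pol sch c z n).2)) ∧
      ((run pol sch c y n).1 = (run pol sch c x n).1 ∧
        (run pol sch c y n).2.mode = (run pol sch c x n).2.mode) ∧
      (run pol sch c z n).1 = (run pol sch c x n).1 ∧
        (run pol sch c z n).2.mode = (run pol sch c x n).2.mode := by
  induction n with
  | zero => exact ⟨rfl, ⟨rfl, hy⟩, rfl, hz⟩
  | succ n ih =>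
    obtain ⟨h1, ⟨h2, h3⟩, h4, h5⟩ := ih
    simp only [run]
    rw [h1, h2, h3, h4, h5]
    have hm : ((run pol sch c x n).2.comb u v (run pol sch c y n).2 (run pol sch c z n).2).mode
        = (run pol sch c x n).2.mode := rfl
    simp only [hm]
    obtain ⟨k1, k2, k3⟩ := update_comb pol sch
      ((run pol sch c x n).1 + holdingTime (c n) (run pol sch c x n).2.mode)
      (nextEvent (c n) (run pol sch c x n).2.mode) u v h3 h5
    exact ⟨Prod.ext rfl k1, ⟨trivial, k2⟩, trivial, k3⟩

theorem age_comb (pol : Policy) (sch : Scheme) (c : ℕ → Clocks) (u v : ℝ) {x y z : DeviceState}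
    (hy : y.mode = x.mode) (hz : z.mode = x.mode) (t : ℝ) :
    age pol sch c (x.comb u v y z) t
      = (1 - u - v) * age pol sch c x t + u * age pol sch c y t + v * age pol sch c z t := by
  have h := run_comb pol sch c u v hy hz
  have e1 : eventCount pol sch c (x.comb u v y z) t = eventCount pol sch c x t := by
    simp only [eventCount, (h _).1]
  have e2 : eventCount pol sch c y t = eventCount pol sch c x t := by
    simp only [eventCount, (h _).2.1.1]
  have e3 : eventCount pol sch c z t = eventCount pol sch c x t := by
    simp only [eventCount, (h _).2.2.1]
  simp only [age, stateAt]
  rw [e1, e2, e3, (h _).1]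
  simp only [DeviceState.comb]
  ring

theorem IsTimeAverage.comb {f g h : ℝ → ℝ} {a : ℝ} (hf : IsTimeAverage f a)
    (hg : IsTimeAverage g a) (hh : IsTimeAverage h a) (u v : ℝ) :
    IsTimeAverage (fun t => (1 - u - v) * f t + u * g t + v * h t) a := by
  have i1 := fun τ hτ => (hf.1 τ hτ).const_mul (1 - u - v)
  have i2 := fun τ hτ => (hg.1 τ hτ).const_mul u
  have i3 := fun τ hτ => (hh.1 τ hτ).const_mul v
  refine ⟨fun τ hτ => ((i1 τ hτ).add (i2 τ hτ)).add (i3 τ hτ), ?_⟩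
  have key := ((hf.2.const_mul (1 - u - v)).add (hg.2.const_mul u)).add (hh.2.const_mul v)
  rw [show (1 - u - v) * a + u * a + v * a = a by ring] at key
  refine key.congr' ?_
  filter_upwards [eventually_ge_atTop 0] with τ hτ
  rw [intervalIntegral.integral_add ((i1 τ hτ).add (i2 τ hτ)) (i3 τ hτ),
    intervalIntegral.integral_add (i1 τ hτ) (i2 τ hτ), intervalIntegral.integral_const_mul,
    intervalIntegral.integral_const_mul, intervalIntegral.integral_const_mul]
  ring

/-- The age process depends affinely on the initial generation times, so that three initial states
per mode suffice. -/
theorem isTimeAverage_age_of_basis {pol : Policy} {sch : Scheme} {c : ℕ → Clocks} {a : ℝ}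
    (h : ∀ m, IsTimeAverage (age pol sch c ⟨m, 0, 0⟩) a ∧
      IsTimeAverage (age pol sch c ⟨m, 1, 0⟩) a ∧ IsTimeAverage (age pol sch c ⟨m, 0, 1⟩) a)
    (x₀ : DeviceState) : IsTimeAverage (age pol sch c x₀) a := by
  obtain ⟨m, r, s⟩ := x₀
  have e : (⟨m, r, s⟩ : DeviceState)
      = DeviceState.comb r s ⟨m, 0, 0⟩ ⟨m, 1, 0⟩ ⟨m, 0, 1⟩ := by
    simp [DeviceState.comb]
  have h1 := (h m).1.comb (h m).2.1 (h m).2.2 r s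
  rw [e]
  convert h1 using 1
  ext t
  exact age_comb pol sch c r s (x := ⟨m, 0, 0⟩) (y := ⟨m, 1, 0⟩) (z := ⟨m, 0, 1⟩) rfl rfl t

/-! ### Almost sure convergence -/

theorem Potential.exists_abs_val_le (φ : Potential) :
    ∃ B, 0 ≤ B ∧ ∀ y, |φ.val y| ≤ B * (1 + y.size) := by
  refine ⟨∑ m, (|φ.const m| + |φ.recv m| + |φ.stor m|),
    Finset.sum_nonneg fun m _ => by positivity, fun y => ?_⟩
  have hS := y.size_nonneg
  have h1 : |y.received| ≤ y.size := le_max_left _ _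
  have h2 : |y.stored| ≤ y.size := le_max_right _ _
  have h3 : |φ.const y.mode| + |φ.recv y.mode| + |φ.stor y.mode|
      ≤ ∑ m, (|φ.const m| + |φ.recv m| + |φ.stor m|) :=
    Finset.single_le_sum (f := fun m => |φ.const m| + |φ.recv m| + |φ.stor m|)
      (fun m _ => by positivity) (Finset.mem_univ y.mode)
  calc |φ.val y| ≤ |φ.const y.mode| + |φ.recv y.mode| * |y.received|
        + |φ.stor y.mode| * |y.stored| := by
        rw [← abs_mul, ← abs_mul]
        exact (abs_sub _ _).trans (add_le_add_left (abs_sub _ _) _)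
    _ ≤ |φ.const y.mode| * (1 + y.size) + |φ.recv y.mode| * (1 + y.size)
        + |φ.stor y.mode| * (1 + y.size) := by
        gcongr
        · exact le_mul_of_one_le_right (abs_nonneg _) (by linarith)
        · linarith
        · linarith
    _ = (|φ.const y.mode| + |φ.recv y.mode| + |φ.stor y.mode|) * (1 + y.size) := by ring
    _ ≤ _ := by gcongr

/-- A common bound for everything that happens in one jump. -/
def jumpBound (y : DeviceState) (c : Clocks) : ℝ := (1 + y.size) * (1 + c.arr) ^ 2

theorem age_terms_le_jumpBound (a : ℝ) (y : DeviceState) {c : Clocks} (hc : c.Pos) :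
    |y.received| * holdingTime c y.mode + holdingTime c y.mode ^ 2 / 2
      + |a| * holdingTime c y.mode ≤ (1 + |a|) * jumpBound y c := by
  have hS := y.size_nonneg
  have h1 : |y.received| ≤ y.size := le_max_left _ _
  have h2 := (hc.holdingTime_pos y.mode).le
  have h3 := holdingTime_le_arr c y.mode
  have h0 := hc.1.le
  have e1 : y.size * c.arr + c.arr ^ 2 / 2 ≤ jumpBound y c := by
    have : 0 ≤ y.size * c.arr := by positivity
    have : 0 ≤ y.size * c.arr ^ 2 := by positivity
    rw [jumpBound]; nlinarith
  have e2 : c.arr ≤ jumpBound y c := by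
    have : 0 ≤ y.size * (1 + c.arr) ^ 2 := by positivity
    rw [jumpBound]; nlinarith
  calc _ ≤ y.size * c.arr + c.arr ^ 2 / 2 + |a| * c.arr := by gcongr
    _ ≤ jumpBound y c + |a| * jumpBound y c := by gcongr
    _ = _ := by ring

theorem one_add_size_le_jumpBound (y : DeviceState) {c : Clocks} (hc : c.Pos) :
    1 + y.size + c.arr ≤ jumpBound y c := by
  have hS := y.size_nonneg
  have h0 := hc.1.le
  have : 0 ≤ y.size * c.arr := by positivity
  have : 0 ≤ y.size * c.arr ^ 2 := by positivity
  rw [jumpBound]; nlinarith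

theorem Potential.exists_abs_jumpGain_le (φ : Potential) (pol : Policy) (sch : Scheme) (a : ℝ) :
    ∃ B, ∀ y (c : Clocks), c.Pos → |φ.jumpGain pol sch a y c| ≤ B * jumpBound y c := by
  obtain ⟨B, hB, hval⟩ := φ.exists_abs_val_le
  refine ⟨1 + |a| + B + B, fun y c hc => ?_⟩
  have h1 := age_terms_le_jumpBound a y hc
  have h2 := one_add_size_le_jumpBound y hc
  have hH := (hc.holdingTime_pos y.mode).le
  have h3 : |φ.val (relStep pol sch y c)| ≤ B * jumpBound y c :=
    (hval _).trans (mul_le_mul_of_nonneg_left (by linarith [size_relStep_le pol sch y hc]) hB)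
  have h4 : |φ.val y| ≤ B * jumpBound y c :=
    (hval _).trans (mul_le_mul_of_nonneg_left (by linarith [hc.1]) hB)
  have e : φ.jumpGain pol sch a y c = -(y.received * holdingTime c y.mode)
      + holdingTime c y.mode ^ 2 / 2 - a * holdingTime c y.mode
      + φ.val (relStep pol sch y c) - φ.val y := by
    rw [jumpGain, gain, relStep]; ring
  rw [e]
  calc _ ≤ |y.received| * holdingTime c y.mode + holdingTime c y.mode ^ 2 / 2
        + |a| * holdingTime c y.mode + |φ.val (relStep pol sch y c)| + |φ.val y| := by
        refine (abs_sub _ _).trans (add_le_add_left ((abs_add_le _ _).trans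
          (add_le_add_left ((abs_sub _ _).trans ?_) _)) _)
        refine add_le_add ((abs_add_le _ _).trans ?_) ?_
        · rw [abs_neg, abs_mul, abs_of_nonneg hH,
            abs_of_nonneg (by positivity : 0 ≤ holdingTime c y.mode ^ 2 / 2)]
        · rw [abs_mul, abs_of_nonneg hH]
    _ ≤ (1 + |a|) * jumpBound y c + B * jumpBound y c + B * jumpBound y c := by gcongr
    _ = _ := by ring

theorem Potential.measurable_val (φ : Potential) : Measurable φ.val :=
  ((Measurable.of_discrete.comp measurable_mode).sub
    ((Measurable.of_discrete.comp measurable_mode).mul measurable_received)).sub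
    ((Measurable.of_discrete.comp measurable_mode).mul measurable_stored)

theorem Potential.measurable_jumpGain (φ : Potential) (pol : Policy) (sch : Scheme) (a : ℝ)
    {α : Type*} [MeasurableSpace α] {y : α → DeviceState} {c : α → Clocks} (hy : Measurable y)
    (hc : Measurable c) : Measurable fun x => φ.jumpGain pol sch a (y x) (c x) := by
  have hH := measurable_holdingTime (measurable_mode.comp hy) hc
  have hr := measurable_received.comp hy
  exact (((((hr.neg.mul hH).add ((hH.pow_const 2).div_const 2)).sub (hH.const_mul a)).add
    (φ.measurable_val.comp (measurable_relStep hy hc)))).sub (φ.measurable_val.comp hy)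

section Convergence

variable {Ω : Type*} [mΩ : MeasurableSpace Ω] {P : Measure Ω}
  {lam k μ : ℝ} {p : unitInterval} {C : ℕ → Ω → Clocks}

/-- The jump times grow at least linearly, by the law of large numbers for the time to the first
ring of all three clocks. -/
theorem IsClockSequence.exists_linear_growth (hC : IsClockSequence P lam k μ p C)
    (hlam : 0 < lam) (hk : 0 < k) (hμ : 0 < μ) (pol : Policy) (sch : Scheme) (x₀ : DeviceState) :
    ∃ δ : ℝ, 0 < δ ∧ ∀ᵐ ω ∂P, ∀ᶠ n : ℕ in atTop,
      δ * n ≤ (run pol sch (fun j => C j ω) x₀ n).1 := by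
  have := isProbabilityMeasure_clockLaw (p := p) hlam hk hμ
  set τ : Clocks → ℝ := fun c => min c.arr (min c.wait c.trans) with hτ
  have hτm : Measurable τ := measurable_arr.min (measurable_wait.min measurable_trans)
  have hpos : ∀ᵐ c ∂(clockLaw lam k μ p), 0 < τ c := by
    filter_upwards [ae_pos_clockLaw hlam hk hμ] with c hc
    exact lt_min hc.1 (lt_min hc.2.1 hc.2.2)
  have hτi : Integrable τ (clockLaw lam k μ p) := by
    have h := (integral_arr_clockLaw (p := p) (f := fun x => x ^ 1) hlam hk hμ
      (integrable_pow_expMeasure hlam 1)).1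
    simp only [pow_one] at h
    refine h.mono hτm.aestronglyMeasurable ?_
    filter_upwards [ae_pos_clockLaw hlam hk hμ, hpos] with c hc h0
    rw [Real.norm_of_nonneg h0.le, Real.norm_of_nonneg hc.1.le]
    exact min_le_left _ _
  have hmean : 0 < ∫ c, τ c ∂(clockLaw lam k μ p) := by
    have h0 : 0 ≤ᵐ[clockLaw lam k μ p] τ := hpos.mono fun c hc => hc.le
    refine lt_of_le_of_ne (integral_nonneg_of_ae h0) fun h => ?_
    have h1 := (integral_eq_zero_iff_of_nonneg_ae h0 hτi).1 h.symm
    obtain ⟨c, hc1, hc2⟩ := (h1.and hpos).exists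
    exact hc2.ne' hc1
  refine ⟨(∫ c, τ c ∂(clockLaw lam k μ p)) / 2, by positivity, ?_⟩
  have hident : ∀ i, IdentDistrib (C i) (C 0) P P := fun i =>
    ⟨(hC.law i).aemeasurable, (hC.law 0).aemeasurable, by rw [(hC.law i).map_eq, (hC.law 0).map_eq]⟩
  have hslln := strong_law_ae_real (fun i ω => τ (C i ω)) (hC.integrable_comp 0 hτi).1
    (fun i j hij => (hC.indep.indepFun hij).comp hτm hτm) (fun i => (hident i).comp hτm)
  filter_upwards [hslln] with ω hω
  rw [(hC.integrable_comp 0 hτi).2] at hω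
  filter_upwards [hω.eventually (lt_mem_nhds (half_lt_self hmean)), eventually_gt_atTop 0]
    with n hn hn0
  have hn' : (0 : ℝ) < n := by exact_mod_cast hn0
  rw [lt_div_iff₀ hn'] at hn
  refine hn.le.trans ?_
  clear hn hn0 hn'
  induction n with
  | zero => simp [run]
  | succ n ih =>
    rw [Finset.sum_range_succ, run_succ_fst]
    exact add_le_add ih (min_le_holdingTime _ _)

variable [IsProbabilityMeasure P]

theorem IsClockSequence.exists_integral_jumpBound_sq_le (hC : IsClockSequence P lam k μ p C)
    (hm : ∀ n, Measurable (C n)) (hlam : 0 < lam) (hk : 0 < k) (hμ : 0 < μ) (hp : 0 < (p : ℝ))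
    (pol : Policy) (sch : Scheme) (y₀ : DeviceState) :
    (∀ n, MemLp (fun ω => jumpBound (relRun pol sch (fun j => C j ω) y₀ n) (C n ω)) 2 P) ∧
    ∃ K, ∀ n, ∫ ω, jumpBound (relRun pol sch (fun j => C j ω) y₀ n) (C n ω) ^ 2 ∂P ≤ K := by
  obtain ⟨K, hK⟩ := hC.exists_integral_size_sq_le hm hlam hk hμ hp pol sch y₀
  have hV := hC.memLp_size hm hlam hk hμ pol sch y₀
  set V : ℕ → Ω → ℝ := fun n ω => (relRun pol sch (fun j => C j ω) y₀ n).size with hVdef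
  have hVm : ∀ n, Measurable[pastInputs C n] (V n) := fun n =>
    @Measurable.comp _ _ _ (pastInputs C n) _ _ _ _ measurable_size (measurable_relRun pol sch y₀ n)
  have hind : ∀ n, IndepFun (fun ω => (1 + V n ω) ^ 2) (fun ω => (1 + (C n ω).arr) ^ 4) P :=
    fun n => (hC.indepFun_past_future hm (n := n) (hVm n) (measurable_futureInputs le_rfl)).comp
      (φ := fun x => (1 + x) ^ 2) (ψ := fun c : Clocks => (1 + c.arr) ^ 4)
      ((measurable_id.const_add 1).pow_const 2) ((measurable_arr.const_add 1).pow_const 4)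
  have h1V : ∀ n, MemLp (fun ω => 1 + V n ω) 2 P := fun n =>
    (memLp_const (1 : ℝ)).add (hV n)
  have i1 : ∀ n, Integrable (fun ω => (1 + V n ω) ^ 2) P := fun n => (h1V n).integrable_sq
  have i2 : ∀ n, Integrable (fun ω => (1 + (C n ω).arr) ^ 4) P ∧
      ∫ ω, (1 + (C n ω).arr) ^ 4 ∂P = ∫ c, (1 + c.arr) ^ 4 ∂(clockLaw lam k μ p) :=
    fun n => hC.integrable_comp n (f := fun c => (1 + c.arr) ^ 4)
      (integrable_one_add_arr_pow hlam hk hμ 4)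
  have e : ∀ n ω, jumpBound (relRun pol sch (fun j => C j ω) y₀ n) (C n ω) ^ 2
      = (1 + V n ω) ^ 2 * (1 + (C n ω).arr) ^ 4 := fun n ω => by
    rw [jumpBound]; ring
  refine ⟨fun n => ?_, (2 + 2 * K) * ∫ c, (1 + c.arr) ^ 4 ∂(clockLaw lam k μ p), fun n => ?_⟩
  · have hmeas : AEStronglyMeasurable
        (fun ω => jumpBound (relRun pol sch (fun j => C j ω) y₀ n) (C n ω)) P :=
      ((((hVm n).mono (pastInputs_le hm n) le_rfl).const_add 1).mul
        (((measurable_arr.comp (hm n)).const_add 1).pow_const 2)).aestronglyMeasurable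
    rw [memLp_two_iff_integrable_sq hmeas]
    simp_rw [e]
    exact (hind n).integrable_mul (i1 n) (i2 n).1
  · simp_rw [e]
    rw [(hind n).integral_fun_mul_eq_mul_integral (i1 n).aestronglyMeasurable
      (i2 n).1.aestronglyMeasurable, (i2 n).2]
    refine mul_le_mul_of_nonneg_right ?_ (integral_nonneg fun c => by positivity)
    calc ∫ ω, (1 + V n ω) ^ 2 ∂P ≤ ∫ ω, 2 + 2 * V n ω ^ 2 ∂P := by
          refine integral_mono (i1 n)
            ((integrable_const _).add ((hV n).integrable_sq.const_mul 2)) fun ω => ?_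
          have := sq_nonneg (1 - V n ω)
          simp only
          nlinarith
      _ = 2 + 2 * ∫ ω, V n ω ^ 2 ∂P := by
          rw [integral_add (integrable_const _) ((hV n).integrable_sq.const_mul 2),
            integral_const_mul]
          simp [hVdef]
      _ ≤ 2 + 2 * K := by linarith [hK n]

/-- The compensated gains of different jumps are orthogonal: given the past, the later one is
centred. -/
theorem IsClockSequence.integral_jumpGain_mul_jumpGain (hC : IsClockSequence P lam k μ p C)
    (hm : ∀ n, Measurable (C n)) (hlam : 0 < lam) (hk : 0 < k) (hμ : 0 < μ)
    {φ : Potential} {pol : Policy} {sch : Scheme} {a : ℝ}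
    (hφ : φ.IsPoissonSolution lam k μ p pol sch a) (y₀ : DeviceState) {i j : ℕ} (hij : i < j) :
    ∫ ω, φ.jumpGain pol sch a (relRun pol sch (fun n => C n ω) y₀ i) (C i ω)
      * φ.jumpGain pol sch a (relRun pol sch (fun n => C n ω) y₀ j) (C j ω) ∂P = 0 := by
  have := isProbabilityMeasure_clockLaw (p := p) hlam hk hμ
  set Z : Ω → ℝ × DeviceState := fun ω =>
    (φ.jumpGain pol sch a (relRun pol sch (fun n => C n ω) y₀ i) (C i ω),
      relRun pol sch (fun n => C n ω) y₀ j) with hZ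
  have hZ1 : Measurable[pastInputs C j] fun ω =>
      φ.jumpGain pol sch a (relRun pol sch (fun n => C n ω) y₀ i) (C i ω) :=
    @Potential.measurable_jumpGain φ pol sch a Ω (pastInputs C j) _ _
      ((measurable_relRun pol sch y₀ i).mono (pastInputs_mono hij.le) le_rfl)
      (measurable_pastInputs hij)
  have hZm : Measurable[pastInputs C j] Z := hZ1.prodMk (measurable_relRun pol sch y₀ j)
  have hZm' : Measurable Z := hZm.mono (pastInputs_le hm j) le_rfl
  have hind : IndepFun Z (C j) P := hC.indepFun_past_future hm hZm (measurable_futureInputs le_rfl)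
  have hmap := hind.map_prod_eq_prod_map_map hZm'.aemeasurable (hm j).aemeasurable
  rw [(hC.law j).map_eq] at hmap
  have hF : Measurable fun q : (ℝ × DeviceState) × Clocks =>
      q.1.1 * φ.jumpGain pol sch a q.1.2 q.2 :=
    measurable_fst.fst.mul (φ.measurable_jumpGain pol sch a measurable_fst.snd measurable_snd)
  have e := integral_map (hZm'.prodMk (hm j)).aemeasurable
    (hF.aestronglyMeasurable (μ := P.map fun ω => (Z ω, C j ω)))
  refine e.symm.trans ?_
  rw [hmap]
  have : IsProbabilityMeasure (P.map Z) := Measure.isProbabilityMeasure_map hZm'.aemeasurable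
  -- without integrability the integral is zero by convention, so that no bound is needed here
  by_cases hint : Integrable (fun q : (ℝ × DeviceState) × Clocks =>
      q.1.1 * φ.jumpGain pol sch a q.1.2 q.2) ((P.map Z).prod (clockLaw lam k μ p))
  · rw [integral_prod _ hint]
    simp_rw [integral_const_mul, Potential.integral_jumpGain hφ hlam hk hμ]
    simp
  · exact integral_undef hint

/-- A solution of the Poisson equation identifies the time average of the age. -/
theorem IsClockSequence.ae_isTimeAverage_age (hC : IsClockSequence P lam k μ p C)
    (hm : ∀ n, Measurable (C n)) (hlam : 0 < lam) (hk : 0 < k) (hμ : 0 < μ) (hp : 0 < (p : ℝ))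
    {φ : Potential} {pol : Policy} {sch : Scheme} {a : ℝ}
    (hφ : φ.IsPoissonSolution lam k μ p pol sch a) (x₀ : DeviceState) :
    ∀ᵐ ω ∂P, IsTimeAverage (age pol sch (fun n => C n ω) x₀) a := by
  obtain ⟨hYL, K, hK⟩ := hC.exists_integral_jumpBound_sq_le hm hlam hk hμ hp pol sch x₀
  obtain ⟨B, hB⟩ := φ.exists_abs_jumpGain_le pol sch a
  obtain ⟨B', hB'0, hB'⟩ := φ.exists_abs_val_le
  obtain ⟨δ, hδ, hlin⟩ := hC.exists_linear_growth hlam hk hμ pol sch x₀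
  have hpos := hC.ae_pos hlam hk hμ
  set y : ℕ → Ω → DeviceState := fun n ω => relRun pol sch (fun j => C j ω) x₀ n with hy
  set Y : ℕ → Ω → ℝ := fun n ω => jumpBound (y n ω) (C n ω) with hYdef
  set G : ℕ → Ω → ℝ := fun n ω => φ.jumpGain pol sch a (y n ω) (C n ω) with hG
  have hym : ∀ n, Measurable (y n) := fun n =>
    (measurable_relRun pol sch x₀ n).mono (pastInputs_le hm n) le_rfl
  have hGbound : ∀ n, ∀ᵐ ω ∂P, |G n ω| ≤ B * Y n ω := fun n =>
    hpos.mono fun ω hω => hB _ _ (hω n)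
  have hGL : ∀ n, MemLp (G n) 2 P := fun n => by
    refine ((hYL n).const_mul B).mono
      (φ.measurable_jumpGain pol sch a (hym n) (hm n)).aestronglyMeasurable ?_
    filter_upwards [hGbound n] with ω hω
    exact hω.trans (le_abs_self _)
  have hGK : ∀ n, ∫ ω, G n ω ^ 2 ∂P ≤ B ^ 2 * K := fun n => by
    calc ∫ ω, G n ω ^ 2 ∂P ≤ ∫ ω, B ^ 2 * Y n ω ^ 2 ∂P := by
          refine integral_mono_ae (hGL n).integrable_sq ((hYL n).integrable_sq.const_mul _) ?_
          filter_upwards [hGbound n] with ω hω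
          rw [← mul_pow]
          exact sq_le_sq.2 (hω.trans (le_abs_self _))
      _ ≤ B ^ 2 * K := by
          rw [integral_const_mul]
          gcongr
          exact hK n
  filter_upwards [hpos, hlin, ae_tendsto_div_nat_of_integral_sq_le hYL hK,
    ae_tendsto_mean_of_orthogonal hGL hGK fun i j hij =>
      hC.integral_jumpGain_mul_jumpGain hm hlam hk hμ hφ x₀ hij] with ω hω hlinω hYω hGω
  refine isTimeAverage_age (fun n m => (hω n).holdingTime_pos m) ?_
    (fun n => age_terms_le_jumpBound a (y n ω) (hω n)) ?_ hδ hlinω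
  · -- the sum of the gains telescopes up to the boundary terms of the potential
    have htel : ∀ n : ℕ, ∑ i ∈ Finset.range n,
        (-(y i ω).received * holdingTime (C i ω) (y i ω).mode
          + holdingTime (C i ω) (y i ω).mode ^ 2 / 2 - a * holdingTime (C i ω) (y i ω).mode)
        = ∑ i ∈ Finset.range n, G i ω - φ.val (y n ω) + φ.val (y 0 ω) := by
      intro n
      have h1 : ∀ i, -(y i ω).received * holdingTime (C i ω) (y i ω).mode
          + holdingTime (C i ω) (y i ω).mode ^ 2 / 2 - a * holdingTime (C i ω) (y i ω).mode
          = G i ω - (φ.val (y (i + 1) ω) - φ.val (y i ω)) := fun i => by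
        change _ = φ.jumpGain pol sch a (y i ω) (C i ω)
          - (φ.val (relStep pol sch (y i ω) (C i ω)) - φ.val (y i ω))
        rw [Potential.jumpGain, Potential.gain, relStep]; ring
      simp_rw [h1]
      rw [Finset.sum_sub_distrib, Finset.sum_range_sub (fun i => φ.val (y i ω))]
      ring
    have hval : Tendsto (fun n : ℕ => φ.val (y n ω) / n) atTop (𝓝 0) := by
      have hlim : Tendsto (fun n : ℕ => B' * (Y n ω / n)) atTop (𝓝 0) := by
        simpa using hYω.const_mul B'
      refine squeeze_zero_norm (fun n => ?_) hlim
      rw [Real.norm_eq_abs, abs_div, Nat.abs_cast, ← mul_div_assoc]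
      gcongr
      refine (hB' _).trans (mul_le_mul_of_nonneg_left ?_ hB'0)
      have := one_add_size_le_jumpBound (y n ω) (hω n)
      have := (hω n).1
      linarith
    have h0 : Tendsto (fun n : ℕ => φ.val (y 0 ω) / n) atTop (𝓝 0) :=
      tendsto_const_div_atTop_nhds_zero_nat _
    have h := (hGω.sub hval).add h0
    rw [sub_zero, add_zero] at h
    refine h.congr fun n => ?_
    rw [← sub_div, ← add_div, ← htel]
  · have h := hYω.const_mul (1 + |a|)
    rw [mul_zero] at h
    refine h.congr fun n => ?_
    rw [mul_div_assoc]

theorem IsClockSequence.hasAverageAge (hC : IsClockSequence P lam k μ p C)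
    (hlam : 0 < lam) (hk : 0 < k) (hμ : 0 < μ) (hp : 0 < (p : ℝ))
    {pol : Policy} {sch : Scheme} {a : ℝ}
    (hφ : ∃ φ : Potential, φ.IsPoissonSolution lam k μ p pol sch a) :
    HasAverageAge P C pol sch a := by
  obtain ⟨φ, hφ⟩ := hφ
  -- the inputs are only almost everywhere measurable, and are replaced by measurable versions
  set C' : ℕ → Ω → Clocks := fun n => (hC.law n).aemeasurable.mk (C n) with hC'def
  have hae : ∀ n, C n =ᵐ[P] C' n := fun n => (hC.law n).aemeasurable.ae_eq_mk
  have hC' : IsClockSequence P lam k μ p C' :=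
    ⟨hC.indep.congr hae, fun n => (hC.law n).congr (hae n).symm⟩
  have hm : ∀ n, Measurable (C' n) := fun n => (hC.law n).aemeasurable.measurable_mk
  have key := fun x₀ => hC'.ae_isTimeAverage_age hm hlam hk hμ hp hφ x₀
  filter_upwards [ae_all_iff.2 hae, ae_all_iff.2 fun m : Mode => key ⟨m, 0, 0⟩,
    ae_all_iff.2 fun m : Mode => key ⟨m, 1, 0⟩, ae_all_iff.2 fun m : Mode => key ⟨m, 0, 1⟩]
    with ω hω h0 h1 h2
  have e : (fun n => C n ω) = fun n => C' n ω := funext hω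
  rw [e]
  exact isTimeAverage_age_of_basis fun m => ⟨h0 m, h1 m, h2 m⟩

end Convergence

end AoI

end

theorem theorem1
    {Ω : Type*} [MeasurableSpace Ω] (P : Measure Ω) [IsProbabilityMeasure P]
    (lam μ w γ : ℝ) (hlam : 0 < lam) (hμ : 0 < μ) (hw : 0 < w) (hγ : 0 < γ)
    (p : unitInterval) (hp : 0 < (p : ℝ))
    (π : AoI.Mode → ℝ) (hπ : π ∈ stdSimplex ℝ AoI.Mode) (hidle : γ * π .service < 1)
    (k : ℝ) (hk : k = AoI.effectiveRate w γ π)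
    (C : ℕ → Ω → AoI.Clocks) (hC : AoI.IsClockSequence P lam k μ p C) :
    AoI.HasAverageAge P C .I .WP
      ((1 / lam + 1 / k + 1 / μ) * (1 / p) + (lam + k + μ) / ((lam + μ) * (lam + k))
        - (lam + k + μ) / (lam * k + k * μ + lam * μ)) ∧
    AoI.HasAverageAge P C .I .WOP
      ((1 / lam + 1 / k + 1 / μ) * (1 / p) + 1 / μ + 1 / (lam + k)
        - (lam + k + μ) / (lam * k + k * μ + lam * μ)) ∧
    AoI.HasAverageAge P C .W .WP
      ((p / lam + 1 / k + 1 / μ) * (1 / p)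
        + (lam + k + μ) / ((lam + μ) * (k + lam) - k * μ * (1 - p))
        - (lam + k + μ) / (lam * k + lam * μ + k * μ * p)) ∧
    AoI.HasAverageAge P C .W .WOP
      ((p / lam + 1 / k + 1 / μ) * (1 / p) + (lam + k + μ) / (μ * (k * p + lam))
        - (lam + k + μ) / (lam * k + lam * μ + k * μ * p)) ∧
    AoI.HasAverageAge P C .S .WP
      (1 / lam + 1 / k + 1 / (μ * p) + (μ * p + k + lam) / ((lam + μ * p) * (lam + k))
        - (lam + k + μ * p) / (lam * k + (k + lam) * (μ * p))) ∧
    AoI.HasAverageAge P C .S .WOP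
      (1 / lam + 1 / k + 2 / (μ * p) + 1 / (lam + k)
        - (lam + k + μ * p) / (lam * k + (k + lam) * (μ * p))) := by
  have hk0 : 0 < k := by
    rw [hk, AoI.effectiveRate]
    exact mul_pos hw (by linarith)
  exact ⟨hC.hasAverageAge hlam hk0 hμ hp (AoI.exists_isPoissonSolution_I_WP hlam hk0 hμ hp),
    hC.hasAverageAge hlam hk0 hμ hp (AoI.exists_isPoissonSolution_I_WOP hlam hk0 hμ hp),
    hC.hasAverageAge hlam hk0 hμ hp (AoI.exists_isPoissonSolution_W_WP hlam hk0 hμ hp),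
    hC.hasAverageAge hlam hk0 hμ hp (AoI.exists_isPoissonSolution_W_WOP hlam hk0 hμ hp),
    hC.hasAverageAge hlam hk0 hμ hp (AoI.exists_isPoissonSolution_S_WP hlam hk0 hμ hp),
    hC.hasAverageAge hlam hk0 hμ hp (AoI.exists_isPoissonSolution_S_WOP hlam hk0 hμ hp)⟩
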